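/- Let $\log$ be the natural logarithm. For a bipartite graph $G=(U,V,E)$ with $|U|=|V|=n$, an integer $d$ and a real $k$, consider the following system (SDP) in vectors $e\in\mathbb{R}^d$ and $u_i\in\mathbb{R}^d$ $(i\in U\cup V)$: \begin{align*} &\|e\|^2=1,\qquad \|u_i\|^2=\langle u_i,e\rangle\ \ (i\in U\cup V),\qquad \sum_{i\in U}\langle u_i,e\rangle=\sum_{j\in V}\langle u_j,e\rangle=k,\\ &\langle u_i,u_j\rangle=0\ \ ((i,j)\in(U\times V)\setminus E),\qquad \langle u_i,u_j\rangle\ge 0\ \ ((i,j)\in U\times V),\\ &\sum_{j\in V}\langle u_i,u_j\rangle=k\langle u_i,e\rangle\ \ (i\in U),\qquad \sum_{i\in U}\langle u_i,u_j\rangle=k\langle u_j,e\rangle\ \ (j\in V). \end{align*} Given a solution, put $t=n/k$ and $c_i=\langle u_i,e\rangle$. One round of rounding is the following. Sample $g\sim\mathcal N(0,I_d)$ and keep a vertex $i\in U\cup V$ iff $c_i\ge\frac1{8t}$ and $\langle g,u_i'/\|u_i'\|\rangle\ge\sqrt{0.1\log n}$, where $u_i'=u_i-(1-1/\sqrt2)\,c_i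 e$. Let $H$ be the induced bipartite graph on the kept vertices, $F$ its number of edges, $Q$ its number of non-edges (pairs in $U\times V$ that are not edges), and $r$ the largest integer with $F-2rQ\ge 2nr$. If $r=0$, the round returns the empty biclique. If $r\ge1$, then, as long as possible, delete a vertex of $H$ whose degree is at most $2r$ times its number of non-neighbours on the other side of the current graph; then pick $r$ remaining vertices of $U$, and $r$ remaining vertices of $V$ adjacent to all of them, and return these. The rounding procedure runs $n^3$ independent rounds and returns a largest biclique found. **Theorem.** There are a constant $D>1$ and a randomized algorithm, running in time polynomial in $n+d$ on a real RAM (unit-cost exact real arithmetic with $\sqrt{\cdot}$, $\log$ and comparisons, and standard Gaussian samples), such that the following holds. Let $n\ge3$, let $G=(U,V,E)$ be a bipartite graph with $|U|=|V|=n$, and let $\{u_i\},e$ be a feasible solution of (SDP) in $\mathbb{R}^d$ with $$k\ge n\cdot\frac{D\log\log n}{\log n}.$$ On input $G,\{u_i\},e,k$, the algorithm carries out the rounding procedure above, and with probability at least $1-e^{-n}$ it outputs a balanced biclique of $G$ of size (number of vertices on each side) at least $n^{1/(D t)}$, where $t=n/k$. -/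

import Mathlib

open MeasureTheory ProbabilityTheory

noncomputable section

namespace BicliqueSDP

/-! ### The instance and the semidefinite relaxation -/

/-- A bipartite graph with `n` vertices on each side (`adj i j` : the vertex `i` of the left side `U`
is joined to the vertex `j` of the right side `V`), together with the data of a candidate SDP
solution in `ℝ^d`: a vector for each vertex of `U` and of `V`, the reference vector `e`, and the
value `k`. -/
structure Instance (n d : ℕ) where
  adj : Fin n → Fin n → Prop
  u : Fin n → EuclideanSpace ℝ (Fin d)
  v : Fin n → EuclideanSpace ℝ (Fin d)
  e : EuclideanSpace ℝ (Fin d)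
  k : ℝ

variable {n d : ℕ}

/-- Feasibility for the SDP relaxation of Maximum Balanced Biclique that includes the
"fractional degree" constraints. -/
structure Instance.Feasible (I : Instance n d) : Prop where
  norm_e : ‖I.e‖ ^ 2 = 1
  norm_u : ∀ i, ‖I.u i‖ ^ 2 = inner ℝ (I.u i) I.e
  norm_v : ∀ j, ‖I.v j‖ ^ 2 = inner ℝ (I.v j) I.e
  sum_u : ∑ i, inner ℝ (I.u i) I.e = I.k
  sum_v : ∑ j, inner ℝ (I.v j) I.e = I.k
  nonedge : ∀ i j, ¬ I.adj i j → inner ℝ (I.u i) (I.v j) = 0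
  nonneg : ∀ i j, 0 ≤ inner ℝ (I.u i) (I.v j)
  fracDeg_u : ∀ i, ∑ j, inner ℝ (I.u i) (I.v j) = I.k * inner ℝ (I.u i) I.e
  fracDeg_v : ∀ j, ∑ i, inner ℝ (I.u i) (I.v j) = I.k * inner ℝ (I.v j) I.e

/-- `(A, B)` is a balanced biclique: `A ⊆ U` and `B ⊆ V` have the same number of vertices and every
vertex of `A` is joined to every vertex of `B`. Its size is `A.card`. -/
def IsBalancedBiclique (adj : Fin n → Fin n → Prop) (A B : Finset (Fin n)) : Prop :=
  A.card = B.card ∧ ∀ i ∈ A, ∀ j ∈ B, adj i j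

/-! ### One round: Gaussian thresholding, then greedy extraction -/

/-- The parameter `t = n / k`. -/
def Instance.t (I : Instance n d) : ℝ := n / I.k

/-- The shifted vector `w - α ⟨w, e⟩ e` with `α = 1 - 1/√2`. -/
def Instance.shift (I : Instance n d) (w : EuclideanSpace ℝ (Fin d)) : EuclideanSpace ℝ (Fin d) :=
  w - ((1 - 1 / √2) * inner ℝ w I.e) • I.e

/-- The vertex carrying the vector `w` is heavy and survives the thresholding against the vector `g`
at level `√(0.1 log n)`. -/
def Instance.Survives (I : Instance n d) (g w : EuclideanSpace ℝ (Fin d)) : Prop :=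
  1 / (8 * I.t) ≤ inner ℝ w I.e ∧
    √((1 / 10) * Real.log n) ≤ inner ℝ g (‖I.shift w‖⁻¹ • I.shift w)

open Classical in
/-- The vertices of `U` that survive. -/
def Instance.survU (I : Instance n d) (g : EuclideanSpace ℝ (Fin d)) : Finset (Fin n) :=
  Finset.univ.filter fun i => I.Survives g (I.u i)

open Classical in
/-- The vertices of `V` that survive. -/
def Instance.survV (I : Instance n d) (g : EuclideanSpace ℝ (Fin d)) : Finset (Fin n) :=
  Finset.univ.filter fun j => I.Survives g (I.v j)

open Classical in
/-- The number of edges between `S ⊆ U` and `T ⊆ V`. -/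
def numEdges (adj : Fin n → Fin n → Prop) (S T : Finset (Fin n)) : ℕ :=
  ((S ×ˢ T).filter fun p => adj p.1 p.2).card

open Classical in
/-- The number of non-edges between `S ⊆ U` and `T ⊆ V`. -/
def numNonedges (adj : Fin n → Fin n → Prop) (S T : Finset (Fin n)) : ℕ :=
  ((S ×ˢ T).filter fun p => ¬ adj p.1 p.2).card

open Classical in
/-- One step of the density cleaning with parameter `r`: delete a vertex whose degree is at most
`2 r` times its number of non-neighbours (on the other side of the current subgraph). -/
inductive CleanStep (adj : Fin n → Fin n → Prop) (r : ℕ) :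
    Finset (Fin n) × Finset (Fin n) → Finset (Fin n) × Finset (Fin n) → Prop
  | left (S T : Finset (Fin n)) (i : Fin n) (hi : i ∈ S)
      (h : (T.filter fun j => adj i j).card ≤ 2 * r * (T.filter fun j => ¬ adj i j).card) :
      CleanStep adj r (S, T) (S.erase i, T)
  | right (S T : Finset (Fin n)) (j : Fin n) (hj : j ∈ T)
      (h : (S.filter fun i => adj i j).card ≤ 2 * r * (S.filter fun i => ¬ adj i j).card) :
      CleanStep adj r (S, T) (S, T.erase j)

/-- `(A, B)` is a possible result of greedy extraction with parameter `r` on the subgraph induced by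
`(S, T)`: clean until no vertex can be deleted, pick `r` of the remaining vertices of `U`, and then
`r` of the remaining vertices of `V` that are adjacent to all of those. -/
def GreedyExtraction (adj : Fin n → Fin n → Prop) (r : ℕ) (S T A B : Finset (Fin n)) : Prop :=
  ∃ S' T' : Finset (Fin n),
    Relation.ReflTransGen (CleanStep adj r) (S, T) (S', T') ∧
    (∀ q, ¬ CleanStep adj r (S', T') q) ∧
    A ⊆ S' ∧ A.card = r ∧ B ⊆ T' ∧ B.card = r ∧ ∀ j ∈ B, ∀ i ∈ A, adj i j

/-- The parameter of the extraction on the subgraph `H` induced by `(S, T)`: the largest integer `r`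
with `F - 2 r Q ≥ 2 n r`, where `H` has `F` edges and `Q` non-edges. -/
def extractionParam (adj : Fin n → Fin n → Prop) (S T : Finset (Fin n)) : ℕ :=
  numEdges adj S T / (2 * (n + numNonedges adj S T))

/-- `(A, B)` is a possible result of one round of rounding with the vector `g`: greedy extraction is
run on the surviving subgraph; the empty biclique is returned if no `r ≥ 1` is admissible. -/
def Instance.RoundOutput (I : Instance n d) (g : EuclideanSpace ℝ (Fin d))
    (A B : Finset (Fin n)) : Prop :=
  (extractionParam I.adj (I.survU g) (I.survV g) = 0 ∧ A = ∅ ∧ B = ∅) ∨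
  (1 ≤ extractionParam I.adj (I.survU g) (I.survV g) ∧
    GreedyExtraction I.adj (extractionParam I.adj (I.survU g) (I.survV g))
      (I.survU g) (I.survV g) A B)

/-- The `l`-th block of `d` entries of a sequence of samples, as a vector of `ℝ^d`. -/
def block (d : ℕ) (ω : ℕ → ℝ) (l : ℕ) : EuclideanSpace ℝ (Fin d) :=
  WithLp.toLp 2 fun a : Fin d => ω (l * d + a)

/-- `(A, B)` is a possible result of the whole rounding procedure on the sequence `ω` of samples:
`n ^ 3` rounds are run, each with the next `d` samples, and a largest biclique found is returned. -/
def Instance.RoundingOutput (I : Instance n d) (ω : ℕ → ℝ) (A B : Finset (Fin n)) : Prop :=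
  (∃ l < n ^ 3, I.RoundOutput (block d ω l) A B) ∧
  ∀ l < n ^ 3, ∀ A' B' : Finset (Fin n), I.RoundOutput (block d ω l) A' B' → A'.card ≤ A.card

/-- The law of an infinite sequence of independent standard Gaussian samples. -/
def gaussianSamples : Measure (ℕ → ℝ) :=
  Measure.infinitePi fun _ : ℕ => gaussianReal 0 1

/-! ### The machine model: a real RAM with Gaussian samples

A program has integer variables and two-dimensional real arrays (each named by a number), and is one
finite text for all input sizes. On reals there are exact rational constants, `+`, `-`, `*`, `/`, `√`,
`log` and comparisons, but no rounding and no conversion back to integers; on integers there are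
only `+`, truncated `-` and comparisons, so that no multiplication of large integers is had at unit
cost. Every operation and every loop iteration takes one unit of time. -/

/-- Integer expressions. -/
inductive NExp
  | const (c : ℕ)
  | var (x : ℕ)
  | add (p q : NExp)
  | sub (p q : NExp)

/-- Real expressions; `get a i j` is the entry `(i, j)` of the array `a`. -/
inductive RExp
  | const (c : ℚ)
  | ofN (p : NExp)
  | get (a : ℕ) (i j : NExp)
  | add (p q : RExp)
  | sub (p q : RExp)
  | mul (p q : RExp)
  | div (p q : RExp)
  | sqrt (p : RExp)
  | log (p : RExp)

/-- Tests. -/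
inductive BExp
  | leN (p q : NExp)
  | leR (p q : RExp)
  | not (b : BExp)
  | and (b c : BExp)

/-- Programs. `gauss a i j` stores a fresh standard Gaussian sample in entry `(i, j)` of the array
`a`; `loop x p c` runs `c` with `x = 0, 1, …, m - 1`, where `m` is the value of `p` on entry. -/
inductive Prog
  | skip
  | setN (x : ℕ) (p : NExp)
  | setR (a : ℕ) (i j : NExp) (p : RExp)
  | gauss (a : ℕ) (i j : NExp)
  | seq (c₁ c₂ : Prog)
  | ite (b : BExp) (c₁ c₂ : Prog)
  | loop (x : ℕ) (p : NExp) (c : Prog)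

/-- A memory state: integer variables, real arrays, the number of Gaussian samples drawn so far, and
the time used so far. -/
structure State where
  nat : ℕ → ℕ
  arr : ℕ → ℕ → ℕ → ℝ
  drawn : ℕ
  time : ℕ

def NExp.eval (s : State) : NExp → ℕ
  | .const c => c
  | .var x => s.nat x
  | .add p q => p.eval s + q.eval s
  | .sub p q => p.eval s - q.eval s

def NExp.cost : NExp → ℕ
  | .const _ => 1
  | .var _ => 1
  | .add p q => p.cost + q.cost + 1
  | .sub p q => p.cost + q.cost + 1

def RExp.eval (s : State) : RExp → ℝ
  | .const c => (c : ℝ)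
  | .ofN p => (p.eval s : ℝ)
  | .get a i j => s.arr a (i.eval s) (j.eval s)
  | .add p q => p.eval s + q.eval s
  | .sub p q => p.eval s - q.eval s
  | .mul p q => p.eval s * q.eval s
  | .div p q => p.eval s / q.eval s
  | .sqrt p => √(p.eval s)
  | .log p => Real.log (p.eval s)

def RExp.cost : RExp → ℕ
  | .const _ => 1
  | .ofN p => p.cost + 1
  | .get _ i j => i.cost + j.cost + 1
  | .add p q => p.cost + q.cost + 1
  | .sub p q => p.cost + q.cost + 1
  | .mul p q => p.cost + q.cost + 1
  | .div p q => p.cost + q.cost + 1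
  | .sqrt p => p.cost + 1
  | .log p => p.cost + 1

def BExp.Holds (s : State) : BExp → Prop
  | .leN p q => p.eval s ≤ q.eval s
  | .leR p q => p.eval s ≤ q.eval s
  | .not b => ¬ b.Holds s
  | .and b c => b.Holds s ∧ c.Holds s

def BExp.cost : BExp → ℕ
  | .leN p q => p.cost + q.cost + 1
  | .leR p q => p.cost + q.cost + 1
  | .not b => b.cost + 1
  | .and b c => b.cost + c.cost + 1

/-- Let `m` units of time pass. -/
def State.tick (s : State) (m : ℕ) : State := { s with time := s.time + m }

/-- Assign `c` to the integer variable `x`. -/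
def State.setNat (s : State) (x c : ℕ) : State :=
  { s with nat := fun y => if y = x then c else s.nat y }

/-- Assign `c` to the entry `(i, j)` of the array `a`. -/
def State.setArr (s : State) (a i j : ℕ) (c : ℝ) : State :=
  { s with arr := fun a' i' j' => if a' = a ∧ i' = i ∧ j' = j then c else s.arr a' i' j' }

open Classical in
/-- The state after running a program from a given state, where `ω` is the sequence of samples. -/
def Prog.exec (ω : ℕ → ℝ) : Prog → State → State
  | .skip, s => s.tick 1
  | .setN x p, s => (s.setNat x (p.eval s)).tick (p.cost + 1)
  | .setR a i j p, s =>
      (s.setArr a (i.eval s) (j.eval s) (p.eval s)).tick (i.cost + j.cost + p.cost + 1)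
  | .gauss a i j, s =>
      { (s.setArr a (i.eval s) (j.eval s) (ω s.drawn)).tick (i.cost + j.cost + 1) with
        drawn := s.drawn + 1 }
  | .seq c₁ c₂, s => c₂.exec ω (c₁.exec ω s)
  | .ite b c₁ c₂, s =>
      if b.Holds s then c₁.exec ω (s.tick (b.cost + 1)) else c₂.exec ω (s.tick (b.cost + 1))
  | .loop x p c, s =>
      Nat.rec (motive := fun _ => State) (s.tick (p.cost + 1))
        (fun i s' => c.exec ω ((s'.setNat x i).tick 1)) (p.eval s)

open Classical in
/-- The input: `n` and `d` are in the integer variables `0` and `1`; the arrays `0, 1, 2, 3, 4` hold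
the adjacency matrix, the vectors of `U`, the vectors of `V`, the vector `e` and the number `k`; the
rest of the memory is zero. -/
def Instance.input (I : Instance n d) : State where
  nat x := if x = 0 then n else if x = 1 then d else 0
  arr a i j :=
    if a = 0 then
      if h : i < n ∧ j < n then if I.adj ⟨i, h.1⟩ ⟨j, h.2⟩ then 1 else 0 else 0
    else if a = 1 then if h : i < n ∧ j < d then I.u ⟨i, h.1⟩ ⟨j, h.2⟩ else 0
    else if a = 2 then if h : i < n ∧ j < d then I.v ⟨i, h.1⟩ ⟨j, h.2⟩ else 0
    else if a = 3 then if h : i = 0 ∧ j < d then I.e ⟨j, h.2⟩ else 0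
    else if a = 4 then if i = 0 ∧ j = 0 then I.k else 0
    else 0
  drawn := 0
  time := 0

open Classical in
/-- The subset of `Fin n` whose indicator is written in column `0` of the array `a`. -/
def State.readSet (n : ℕ) (s : State) (a : ℕ) : Finset (Fin n) :=
  Finset.univ.filter fun i => s.arr a i 0 ≠ 0

/-- The left part of the output of a program, written in the array `5`. -/
def Prog.outU (P : Prog) (I : Instance n d) (ω : ℕ → ℝ) : Finset (Fin n) :=
  (P.exec ω I.input).readSet n 5

/-- The right part of the output of a program, written in the array `6`. -/
def Prog.outV (P : Prog) (I : Instance n d) (ω : ℕ → ℝ) : Finset (Fin n) :=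
  (P.exec ω I.input).readSet n 6

/-- The running time of a program. -/
def Prog.runTime (P : Prog) (I : Instance n d) (ω : ℕ → ℝ) : ℕ :=
  (P.exec ω I.input).time

/-- A program runs in polynomial time: on all inputs, and whatever the samples are, its running time
is at most a fixed polynomial in `n + d`. -/
def Prog.PolyTime (P : Prog) : Prop :=
  ∃ C : ℕ, ∀ (n d : ℕ) (I : Instance n d) (ω : ℕ → ℝ), P.runTime I ω ≤ C * (n + d + 1) ^ C

end BicliqueSDP

end

noncomputable section

namespace BicliqueSDP

variable {n d : ℕ}

/-! One round is analysed by a first moment. The shift multiplies the component along e by 1/√2, so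
⟨u_i', u_j'⟩ = ⟨u_i, u_j⟩ - c_i c_j / 2. For heavy non-adjacent vertices this equals -c_i c_j / 2,
and the normalized vectors have correlation at most -1/(16t) (`inner_normalized_le`). The fractional
degree constraints keep at least 3k²/4 of the total weight k² of ⟨u_i, u_j⟩ on heavy pairs, whereas
c_i c_j sums to at most k². Hence at least k²/4 heavy pairs are positively correlated after the
shift, and all of these are edges (`card_goodPairs`, `adj_of_mem_goodPairs`).

Let s² = 0.1 log n. A non-edge survives with probability at most exp(-s²(1 + 1/(16t)))
(`stdGaussian_pair_le`), a good pair with probability at least of order exp(-s²)/s²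
(`stdGaussian_pair_ge`). The advantage n^(1/(160t)) outweighs the factor log n, the density loss 4t²
and the factor 2r with r about n^(1/(Dt)), because the bound on k gives t ≤ log n ≤ n^(1/(Dt)). So F
- 2rQ - 2nr has expectation at least n (`first_moment_ge`). It never exceeds n², hence it is
nonnegative with probability at least 1/n, and n³ independent rounds all fail with probability at
most exp(-n²).

Given F - 2rQ ≥ 2nr, extraction always succeeds: cleaning preserves the inequality, which leaves at
least 2r vertices on each side, and each remaining vertex misses at most a 1/(2r) fraction of the
other side, so r vertices together miss at most half of it (`le_card_common`).

The algorithm is an explicit program, verified with loop invariants and a frame rule (`exec_agree`).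
All its loops are bounded by n or d, which makes it polynomial (`Prog.Tame.time_le`). -/

/-! ### Reasoning about programs -/

/-- The integer variables that a program may write. -/
def Prog.nats : Prog → List ℕ
  | .skip => []
  | .setN x _ => [x]
  | .setR _ _ _ _ => []
  | .gauss _ _ _ => []
  | .seq c₁ c₂ => c₁.nats ++ c₂.nats
  | .ite _ c₁ c₂ => c₁.nats ++ c₂.nats
  | .loop x _ c => x :: c.nats

/-- The arrays that a program may write. -/
def Prog.arrs : Prog → List ℕ
  | .skip => []
  | .setN _ _ => []
  | .setR a _ _ _ => [a]
  | .gauss a _ _ => [a]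
  | .seq c₁ c₂ => c₁.arrs ++ c₂.arrs
  | .ite _ c₁ c₂ => c₁.arrs ++ c₂.arrs
  | .loop _ _ c => c.arrs

/-- Whether a program may draw samples. -/
def Prog.draws : Prog → Bool
  | .skip => false
  | .setN _ _ => false
  | .setR _ _ _ _ => false
  | .gauss _ _ _ => true
  | .seq c₁ c₂ => c₁.draws || c₂.draws
  | .ite _ c₁ c₂ => c₁.draws || c₂.draws
  | .loop _ _ c => c.draws

/-- The loop bounds of a program are the variables `0` and `1`, which it does not write. -/
def Prog.Tame : Prog → Prop
  | .skip => True
  | .setN x _ => 2 ≤ x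
  | .setR _ _ _ _ => True
  | .gauss _ _ _ => True
  | .seq c₁ c₂ => c₁.Tame ∧ c₂.Tame
  | .ite _ c₁ c₂ => c₁.Tame ∧ c₂.Tame
  | .loop x p c => 2 ≤ x ∧ (p = .var 0 ∨ p = .var 1) ∧ c.Tame

/-- Two states agree outside the given integer variables and arrays. -/
structure State.Agree (xs as : List ℕ) (s s' : State) : Prop where
  nat : ∀ y, y ∉ xs → s'.nat y = s.nat y
  arr : ∀ a, a ∉ as → s'.arr a = s.arr a

@[simp] theorem State.tick_nat (s : State) (m : ℕ) : (s.tick m).nat = s.nat := rfl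
@[simp] theorem State.tick_arr (s : State) (m : ℕ) : (s.tick m).arr = s.arr := rfl
@[simp] theorem State.tick_drawn (s : State) (m : ℕ) : (s.tick m).drawn = s.drawn := rfl
@[simp] theorem State.tick_time (s : State) (m : ℕ) : (s.tick m).time = s.time + m := rfl
@[simp] theorem State.setNat_arr (s : State) (x c : ℕ) : (s.setNat x c).arr = s.arr := rfl
@[simp] theorem State.setNat_drawn (s : State) (x c : ℕ) : (s.setNat x c).drawn = s.drawn := rfl
@[simp] theorem State.setNat_time (s : State) (x c : ℕ) : (s.setNat x c).time = s.time := rfl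
@[simp] theorem State.setNat_nat (s : State) (x c y : ℕ) :
    (s.setNat x c).nat y = if y = x then c else s.nat y := rfl
@[simp] theorem State.setArr_nat (s : State) (a i j : ℕ) (c : ℝ) :
    (s.setArr a i j c).nat = s.nat := rfl
@[simp] theorem State.setArr_drawn (s : State) (a i j : ℕ) (c : ℝ) :
    (s.setArr a i j c).drawn = s.drawn := rfl
@[simp] theorem State.setArr_arr (s : State) (a i j : ℕ) (c : ℝ) (a' i' j' : ℕ) :
    (s.setArr a i j c).arr a' i' j' = if a' = a ∧ i' = i ∧ j' = j then c else s.arr a' i' j' := rfl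

theorem State.Agree.trans {xs as : List ℕ} {s s' s'' : State} (h : s.Agree xs as s')
    (h' : s'.Agree xs as s'') : s.Agree xs as s'' :=
  ⟨fun y hy => (h'.nat y hy).trans (h.nat y hy), fun a ha => (h'.arr a ha).trans (h.arr a ha)⟩

theorem State.Agree.mono {xs as xs' as' : List ℕ} {s s' : State} (h : s.Agree xs as s')
    (hx : xs ⊆ xs') (ha : as ⊆ as') : s.Agree xs' as' s' :=
  ⟨fun y hy => h.nat y fun hc => hy (hx hc), fun a hy => h.arr a fun hc => hy (ha hc)⟩

@[simp] theorem exec_skip (ω : ℕ → ℝ) (s : State) : Prog.skip.exec ω s = s.tick 1 := rfl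
@[simp] theorem exec_setN (ω : ℕ → ℝ) (x : ℕ) (p : NExp) (s : State) :
    (Prog.setN x p).exec ω s = (s.setNat x (p.eval s)).tick (p.cost + 1) := rfl
@[simp] theorem exec_setR (ω : ℕ → ℝ) (a : ℕ) (i j : NExp) (p : RExp) (s : State) :
    (Prog.setR a i j p).exec ω s =
      (s.setArr a (i.eval s) (j.eval s) (p.eval s)).tick (i.cost + j.cost + p.cost + 1) := rfl
@[simp] theorem exec_seq (ω : ℕ → ℝ) (c₁ c₂ : Prog) (s : State) :
    (Prog.seq c₁ c₂).exec ω s = c₂.exec ω (c₁.exec ω s) := rfl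

open Classical in
theorem exec_ite (ω : ℕ → ℝ) (b : BExp) (c₁ c₂ : Prog) (s : State) :
    (Prog.ite b c₁ c₂).exec ω s =
      if b.Holds s then c₁.exec ω (s.tick (b.cost + 1)) else c₂.exec ω (s.tick (b.cost + 1)) := rfl

theorem exec_ite_pos {b : BExp} {s : State} (h : b.Holds s) (ω : ℕ → ℝ) (c₁ c₂ : Prog) :
    (Prog.ite b c₁ c₂).exec ω s = c₁.exec ω (s.tick (b.cost + 1)) := by
  rw [exec_ite, if_pos h]

theorem exec_ite_neg {b : BExp} {s : State} (h : ¬ b.Holds s) (ω : ℕ → ℝ) (c₁ c₂ : Prog) :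
    (Prog.ite b c₁ c₂).exec ω s = c₂.exec ω (s.tick (b.cost + 1)) := by
  rw [exec_ite, if_neg h]

/-- The bare rule is what `exec_agree` is proved from; `exec_loop_induction` then feeds that frame
information back into the invariant. -/
theorem exec_loop_induction_aux (ω : ℕ → ℝ) (x : ℕ) (p : NExp) (c : Prog) (s : State)
    (J : ℕ → State → Prop) (h0 : J 0 (s.tick (p.cost + 1)))
    (hs : ∀ i < p.eval s, ∀ s', J i s' → J (i + 1) (c.exec ω ((s'.setNat x i).tick 1))) :
    J (p.eval s) ((Prog.loop x p c).exec ω s) := by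
  have key : ∀ m ≤ p.eval s, J m (Nat.rec (motive := fun _ => State) (s.tick (p.cost + 1))
      (fun i s' => c.exec ω ((s'.setNat x i).tick 1)) m) := by
    intro m
    induction m with
    | zero => intro _; exact h0
    | succ m ih => intro hm; exact hs m (by omega) _ (ih (by omega))
  exact key _ le_rfl

/-- A program changes only the variables and arrays that it may write. -/
theorem exec_agree (ω : ℕ → ℝ) (c : Prog) (s : State) : s.Agree c.nats c.arrs (c.exec ω s) := by
  induction c generalizing s with
  | skip => exact ⟨fun _ _ => rfl, fun _ _ => rfl⟩
  | setN x p =>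
    refine ⟨fun y hy => ?_, fun _ _ => rfl⟩
    simp [Prog.nats] at hy
    simp [hy]
  | setR a i j p =>
    refine ⟨fun _ _ => rfl, fun b hb => ?_⟩
    simp [Prog.arrs] at hb
    ext i' j'
    simp [hb]
  | gauss a i j =>
    refine ⟨fun _ _ => rfl, fun b hb => ?_⟩
    simp [Prog.arrs] at hb
    ext i' j'
    simp [hb, Prog.exec]
  | seq c₁ c₂ h₁ h₂ =>
    exact ((h₁ s).mono (List.subset_append_left _ _) (List.subset_append_left _ _)).trans
      ((h₂ _).mono (List.subset_append_right _ _) (List.subset_append_right _ _))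
  | ite b c₁ c₂ h₁ h₂ =>
    rw [exec_ite]
    split_ifs
    · have := (h₁ (s.tick (b.cost + 1))).mono (List.subset_append_left c₁.nats c₂.nats)
        (List.subset_append_left c₁.arrs c₂.arrs)
      exact ⟨this.nat, this.arr⟩
    · have := (h₂ (s.tick (b.cost + 1))).mono (List.subset_append_right c₁.nats c₂.nats)
        (List.subset_append_right c₁.arrs c₂.arrs)
      exact ⟨this.nat, this.arr⟩
  | loop x p c h =>
    refine exec_loop_induction_aux ω x p c s (fun _ s' => s.Agree (x :: c.nats) c.arrs s')
      ⟨fun _ _ => rfl, fun _ _ => rfl⟩ fun i _ s' hs' => hs'.trans ?_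
    refine State.Agree.trans (s' := (s'.setNat x i).tick 1) ⟨fun y hy => ?_, fun _ _ => rfl⟩
      ((h _).mono (List.subset_cons_self _ _) (List.Subset.refl _))
    simp at hy
    simp [hy]

theorem exec_nat_of_notMem {c : Prog} {y : ℕ} (h : y ∉ c.nats) (ω : ℕ → ℝ) (s : State) :
    (c.exec ω s).nat y = s.nat y := (exec_agree ω c s).nat y h

theorem exec_arr_of_notMem {c : Prog} {a : ℕ} (h : a ∉ c.arrs) (ω : ℕ → ℝ) (s : State) :
    (c.exec ω s).arr a = s.arr a := (exec_agree ω c s).arr a h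

theorem exec_drawn {c : Prog} (hc : c.draws = false) (ω : ℕ → ℝ) (s : State) :
    (c.exec ω s).drawn = s.drawn := by
  induction c generalizing s with
  | skip => rfl
  | setN x p => rfl
  | setR a i j p => rfl
  | gauss a i j => simp [Prog.draws] at hc
  | seq c₁ c₂ h₁ h₂ =>
    simp [Prog.draws] at hc
    simp [h₁ hc.1, h₂ hc.2]
  | ite b c₁ c₂ h₁ h₂ =>
    simp [Prog.draws] at hc
    rw [exec_ite]
    split_ifs
    · simp [h₁ hc.1]
    · simp [h₂ hc.2]
  | loop x p c h =>
    refine exec_loop_induction_aux ω x p c s (fun _ s' => s'.drawn = s.drawn) rfl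
      fun i _ s' hs' => ?_
    rw [h hc]
    exact hs'

/-- The invariant rule for loops; the variables that the loop does not write come for free. -/
theorem exec_loop_induction (ω : ℕ → ℝ) (x : ℕ) (p : NExp) (c : Prog) (s : State)
    (J : ℕ → State → Prop) (h0 : J 0 (s.tick (p.cost + 1)))
    (hs : ∀ i < p.eval s, ∀ s', s.Agree (x :: c.nats) c.arrs s' → J i s' →
      J (i + 1) (c.exec ω ((s'.setNat x i).tick 1))) :
    J (p.eval s) ((Prog.loop x p c).exec ω s) := by
  refine (exec_loop_induction_aux ω x p c s
    (fun i s' => s.Agree (x :: c.nats) c.arrs s' ∧ J i s')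
    ⟨⟨fun _ _ => rfl, fun _ _ => rfl⟩, h0⟩ ?_).2
  rintro i hi s' ⟨ha, hJ⟩
  refine ⟨ha.trans ?_, hs i hi s' ha hJ⟩
  refine State.Agree.trans (s' := (s'.setNat x i).tick 1) ⟨fun y hy => ?_, fun _ _ => rfl⟩
    ((exec_agree ω c _).mono (List.subset_cons_self _ _) (List.Subset.refl _))
  simp at hy
  simp [hy]

theorem Prog.Tame.notMem_nats {c : Prog} (hc : c.Tame) {y : ℕ} (hy : y < 2) : y ∉ c.nats := by
  induction c with
  | skip => simp [Prog.nats]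
  | setN x p => simp only [Prog.Tame] at hc; simp [Prog.nats]; omega
  | setR a i j p => simp [Prog.nats]
  | gauss a i j => simp [Prog.nats]
  | seq c₁ c₂ h₁ h₂ => simp [Prog.nats, h₁ hc.1, h₂ hc.2]
  | ite b c₁ c₂ h₁ h₂ => simp [Prog.nats, h₁ hc.1, h₂ hc.2]
  | loop x p c h =>
    have := hc.1
    simp only [Prog.nats, List.mem_cons, not_or]
    exact ⟨by omega, h hc.2.2⟩

/-- A program whose loop bounds are the input sizes runs in polynomial time. -/
theorem Prog.Tame.time_le {c : Prog} (hc : c.Tame) :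
    ∃ C : ℕ, ∀ (ω : ℕ → ℝ) (s : State),
      (c.exec ω s).time ≤ s.time + C * (s.nat 0 + s.nat 1 + 1) ^ C := by
  have mono : ∀ {C C' m : ℕ}, C ≤ C' → C * (m + 1) ^ C ≤ C' * (m + 1) ^ C' := fun h =>
    Nat.mul_le_mul h (Nat.pow_le_pow_right (Nat.succ_pos _) h)
  have const : ∀ {K m : ℕ}, K ≤ K * (m + 1) ^ K := fun {K m} =>
    Nat.le_mul_of_pos_right _ (Nat.pow_pos (Nat.succ_pos _))
  induction c with
  | skip => exact ⟨1, fun ω s => by simp⟩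
  | setN x p => exact ⟨p.cost + 1, fun ω s => Nat.add_le_add_left const _⟩
  | setR a i j p => exact ⟨i.cost + j.cost + p.cost + 1, fun ω s => Nat.add_le_add_left const _⟩
  | gauss a i j =>
    exact ⟨i.cost + j.cost + 1, fun ω s => Nat.add_le_add_left const _⟩
  | seq c₁ c₂ h₁ h₂ =>
    obtain ⟨C₁, h₁⟩ := h₁ hc.1
    obtain ⟨C₂, h₂⟩ := h₂ hc.2
    refine ⟨C₁ + C₂, fun ω s => ?_⟩
    have e0 : (c₁.exec ω s).nat 0 = s.nat 0 :=
      exec_nat_of_notMem (hc.1.notMem_nats (by norm_num)) ω s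
    have e1 : (c₁.exec ω s).nat 1 = s.nat 1 :=
      exec_nat_of_notMem (hc.1.notMem_nats (by norm_num)) ω s
    have a := h₁ ω s
    have b := h₂ ω (c₁.exec ω s)
    rw [e0, e1] at b
    have p₁ : (s.nat 0 + s.nat 1 + 1) ^ C₁ ≤ (s.nat 0 + s.nat 1 + 1) ^ (C₁ + C₂) :=
      Nat.pow_le_pow_right (Nat.succ_pos _) (Nat.le_add_right _ _)
    have p₂ : (s.nat 0 + s.nat 1 + 1) ^ C₂ ≤ (s.nat 0 + s.nat 1 + 1) ^ (C₁ + C₂) :=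
      Nat.pow_le_pow_right (Nat.succ_pos _) (Nat.le_add_left _ _)
    rw [exec_seq, add_mul]
    have := Nat.mul_le_mul_left C₁ p₁
    have := Nat.mul_le_mul_left C₂ p₂
    omega
  | ite b c₁ c₂ h₁ h₂ =>
    obtain ⟨C₁, h₁⟩ := h₁ hc.1
    obtain ⟨C₂, h₂⟩ := h₂ hc.2
    refine ⟨C₁ + C₂ + (b.cost + 1), fun ω s => ?_⟩
    have p₁ : (s.nat 0 + s.nat 1 + 1) ^ C₁ ≤ (s.nat 0 + s.nat 1 + 1) ^ (C₁ + C₂ + (b.cost + 1)) :=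
      Nat.pow_le_pow_right (Nat.succ_pos _) (by omega)
    have p₂ : (s.nat 0 + s.nat 1 + 1) ^ C₂ ≤ (s.nat 0 + s.nat 1 + 1) ^ (C₁ + C₂ + (b.cost + 1)) :=
      Nat.pow_le_pow_right (Nat.succ_pos _) (by omega)
    have p₃ : b.cost + 1 ≤ (b.cost + 1) * (s.nat 0 + s.nat 1 + 1) ^ (C₁ + C₂ + (b.cost + 1)) :=
      Nat.le_mul_of_pos_right _ (Nat.pow_pos (Nat.succ_pos _))
    have q₁ := Nat.mul_le_mul_left C₁ p₁
    have q₂ := Nat.mul_le_mul_left C₂ p₂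
    rw [exec_ite, add_mul, add_mul]
    split_ifs
    · have := h₁ ω (s.tick (b.cost + 1))
      simp only [State.tick_time, State.tick_nat] at this
      omega
    · have := h₂ ω (s.tick (b.cost + 1))
      simp only [State.tick_time, State.tick_nat] at this
      omega
  | loop x p c h =>
    obtain ⟨C, h⟩ := h hc.2.2
    have hx := hc.1
    -- One more power of m pays for at most m iterations, m (C m^C + 1) ≤ (C + 1) m^(C + 1); the
    -- summand `p.cost + 1` pays for evaluating the bound on entry.
    refine ⟨C + 1 + (p.cost + 1), fun ω s => ?_⟩
    set m := s.nat 0 + s.nat 1 + 1 with hm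
    have hp : p.eval s ≤ m := by
      rcases hc.2.1 with rfl | rfl <;> simp only [NExp.eval] <;> omega
    have key := exec_loop_induction ω x p c s
      (fun i s' => s'.time ≤ s.time + (p.cost + 1) + i * (C * m ^ C + 1)) (by simp) (by
        intro i _ s' ha hs'
        have := h ω ((s'.setNat x i).tick 1)
        have e0 := ha.nat 0 (by
          have := hc.2.2.notMem_nats (y := 0) (by norm_num)
          simp only [List.mem_cons, not_or]; exact ⟨by omega, this⟩)
        have e1 := ha.nat 1 (by
          have := hc.2.2.notMem_nats (y := 1) (by norm_num)
          simp only [List.mem_cons, not_or]; exact ⟨by omega, this⟩)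
        have n0 : ¬ (0 = x) := by omega
        have n1 : ¬ (1 = x) := by omega
        simp only [State.tick_time, State.tick_nat, State.setNat_nat, n0, n1, if_false,
          State.setNat_time, e0, e1, ← hm] at this
        rw [add_mul]
        omega)
    refine key.trans ?_
    have hm1 : 1 ≤ m := by omega
    have s1 : p.eval s * (C * m ^ C + 1) ≤ (C + 1) * m ^ (C + 1 + (p.cost + 1)) := by
      calc p.eval s * (C * m ^ C + 1) ≤ m * (C * m ^ C + m ^ C) := by
            gcongr; exact Nat.one_le_pow _ _ hm1
        _ = (C + 1) * m ^ (C + 1) := by ring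
        _ ≤ _ := Nat.mul_le_mul_left _ (Nat.pow_le_pow_right hm1 (by omega))
    have s2 : p.cost + 1 ≤ (p.cost + 1) * m ^ (C + 1 + (p.cost + 1)) :=
      Nat.le_mul_of_pos_right _ (Nat.pow_pos hm1)
    rw [add_mul _ (p.cost + 1)]
    omega

theorem Prog.Tame.polyTime {c : Prog} (hc : c.Tame) : c.PolyTime := by
  obtain ⟨C, hC⟩ := hc.time_le
  refine ⟨C, fun n d I ω => ?_⟩
  have := hC ω I.input
  simpa [Prog.runTime, Instance.input] using this

/-! ### Counters, sums and indicator arrays -/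

/-- The column `0` of the array `a` is the indicator of `S`. -/
def State.Rep (s : State) (a : ℕ) (S : Finset (Fin n)) : Prop :=
  ∀ i : Fin n, s.arr a i 0 = if i ∈ S then 1 else 0

/-- The vertex in the variable `x` belongs to the set whose indicator is the array `a`. -/
def memTest (a x : ℕ) : BExp := .leR (.const 1) (.get a (.var x) (.const 0))

/-- The vertex of `U` in the variable `x` is adjacent to the vertex of `V` in the variable `y`. -/
def adjTest (x y : ℕ) : BExp := .leR (.const 1) (.get 0 (.var x) (.var y))

theorem State.Rep.memTest_iff {s : State} {a x : ℕ} {S : Finset (Fin n)} (h : s.Rep a S)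
    (i : Fin n) (hi : s.nat x = i) : (memTest a x).Holds s ↔ i ∈ S := by
  simp only [memTest, BExp.Holds, RExp.eval, NExp.eval, hi, h i]
  split_ifs with hS <;> simp [hS]

theorem State.Rep.of_arr_eq {s s' : State} {a : ℕ} {S : Finset (Fin n)} (h : s.Rep a S)
    (e : s'.arr a = s.arr a) : s'.Rep a S := fun i => by rw [e]; exact h i

theorem State.Rep.readSet_eq {s : State} {a : ℕ} {S : Finset (Fin n)} (h : s.Rep a S) :
    s.readSet n a = S := by
  ext i
  simp [State.readSet, h i]

/-- The body may itself be a counting loop; this is how nested counts over pairs are evaluated. -/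
theorem exec_loop_nat_sum (ω : ℕ → ℝ) (x dst : ℕ) (p : NExp) (c : Prog) (s : State) (f : ℕ → ℕ)
    (hf : ∀ i < p.eval s, ∀ s', s.Agree (x :: c.nats) c.arrs s' →
      (c.exec ω ((s'.setNat x i).tick 1)).nat dst = s'.nat dst + f i) :
    ((Prog.loop x p c).exec ω s).nat dst = s.nat dst + ∑ i ∈ Finset.range (p.eval s), f i := by
  refine exec_loop_induction ω x p c s
    (fun m s' => s'.nat dst = s.nat dst + ∑ i ∈ Finset.range m, f i) (by simp) ?_
  intro i hi s' ha hJ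
  rw [hf i hi s' ha, hJ, Finset.sum_range_succ, add_assoc]

/-- Add to the variable `dst` the number of `x < n` that pass the test. -/
def countLoop (x dst : ℕ) (b : BExp) : Prog :=
  .loop x (.var 0) (.ite b (.setN dst (.add (.var dst) (.const 1))) .skip)

-- The test has to be understood only in states that differ from `s` in the loop variable and the
-- counter, so it may refer to an outer loop variable.
open Classical in
theorem exec_countLoop (ω : ℕ → ℝ) {x dst : ℕ} (b : BExp) (s : State) (hn : s.nat 0 = n)
    (hx : x ≠ dst) (P : Fin n → Prop)
    (hb : ∀ (i : Fin n) (s' : State), (∀ y, y ≠ x → y ≠ dst → s'.nat y = s.nat y) →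
      s'.nat x = i → s'.arr = s.arr → (b.Holds s' ↔ P i)) :
    ((countLoop x dst b).exec ω s).nat dst = s.nat dst + (Finset.univ.filter P).card := by
  rw [countLoop, exec_loop_nat_sum ω x dst _ _ s
    (fun i => if h : i < n then if P ⟨i, h⟩ then 1 else 0 else 0)]
  · simp only [NExp.eval, hn]
    rw [Finset.sum_range, Finset.card_filter]
    simp
  · intro i hi s' ha
    simp only [NExp.eval, hn] at hi
    have := hb ⟨i, hi⟩ ((s'.setNat x i).tick 1) (fun y h1 h2 => by
      simp only [State.tick_nat, State.setNat_nat, h1, if_false]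
      exact ha.nat y (by simp [Prog.nats, h1, h2])) (by simp) (by
      ext a : 1
      exact ha.arr a (by simp [Prog.arrs]))
    rw [exec_ite]
    simp only [this, hi, dif_pos]
    split_ifs
    · simp [NExp.eval, hx.symm]
    · simp [hx.symm]

/-- Store in entry `(0, 0)` of the array `a` the sum of the values of `e` over `x < p`. -/
def sumLoop (x : ℕ) (p : NExp) (a : ℕ) (e : RExp) : Prog :=
  .seq (.setR a (.const 0) (.const 0) (.const 0))
    (.loop x p (.setR a (.const 0) (.const 0) (.add (.get a (.const 0) (.const 0)) e)))

theorem exec_sumLoop (ω : ℕ → ℝ) {x a m : ℕ} {p : NExp} (e : RExp) (s : State)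
    (hm : ∀ s' : State, s'.nat = s.nat → p.eval s' = m) (f : Fin m → ℝ)
    (he : ∀ (i : Fin m) (s' : State), (∀ y, y ≠ x → s'.nat y = s.nat y) → s'.nat x = i →
      (∀ b, b ≠ a → s'.arr b = s.arr b) → e.eval s' = f i) :
    ((sumLoop x p a e).exec ω s).arr a 0 0 = ∑ i, f i := by
  rw [sumLoop, exec_seq]
  set s₁ := (Prog.setR a (.const 0) (.const 0) (.const 0)).exec ω s with hs₁
  have hp : p.eval s₁ = m := hm s₁ rfl
  have h0 : s₁.arr a 0 0 = 0 := by simp [hs₁, NExp.eval, RExp.eval]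
  have hb₁ : ∀ b, b ≠ a → s₁.arr b = s.arr b := fun b hb =>
    exec_arr_of_notMem (by simpa [Prog.arrs] using hb) ω s
  set g : ℕ → ℝ := fun i => if h : i < m then f ⟨i, h⟩ else 0 with hg
  have := exec_loop_induction ω x p
    (.setR a (.const 0) (.const 0) (.add (.get a (.const 0) (.const 0)) e)) s₁
    (fun m s' => s'.arr a 0 0 = ∑ i ∈ Finset.range m, g i) (by simpa using h0) (by
      intro i hi s' ha hJ
      rw [hp] at hi
      have := he ⟨i, hi⟩ ((s'.setNat x i).tick 1) (fun y h1 => by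
        simp only [State.tick_nat, State.setNat_nat, h1, if_false]
        exact ha.nat y (by simp [Prog.nats, h1])) (by simp) (fun b hb =>
        (ha.arr b (by simpa [Prog.arrs] using hb)).trans (hb₁ b hb))
      simp only [exec_setR, NExp.eval, RExp.eval, this]
      simp [hJ, Finset.sum_range_succ, hg, hi])
  rw [hp] at this
  rw [this, Finset.sum_range]
  simp [hg]

/-- Write in the array `dst` the indicator of the `x < n` that pass the test after `c`. -/
def markLoop (x dst : ℕ) (c : Prog) (b : BExp) : Prog :=
  .loop x (.var 0) (.seq c
    (.ite b (.setR dst (.var x) (.const 0) (.const 1)) (.setR dst (.var x) (.const 0) (.const 0))))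

/-- `c` computes auxiliary values for the current vertex before the test. It may overwrite its own
scratch memory in each iteration, but neither the loop variable nor the indicator being written. -/
theorem exec_markLoop (ω : ℕ → ℝ) {x dst : ℕ} (c : Prog) (b : BExp) (s : State) (hn : s.nat 0 = n)
    (hx : x ∉ c.nats) (hd : dst ∉ c.arrs) (S : Finset (Fin n))
    (hb : ∀ (i : Fin n) (s' : State), s.Agree (x :: c.nats) (dst :: c.arrs) s' →
      s'.nat x = i → (b.Holds (c.exec ω s') ↔ i ∈ S)) :
    ((markLoop x dst c b).exec ω s).Rep dst S := by
  have := exec_loop_induction ω x (.var 0) (.seq c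
    (.ite b (.setR dst (.var x) (.const 0) (.const 1)) (.setR dst (.var x) (.const 0) (.const 0))))
    s (fun m s' => ∀ i : Fin n, i.1 < m → s'.arr dst i 0 = if i ∈ S then 1 else 0) (by simp) (by
      intro i hi s' ha hJ
      simp only [NExp.eval, hn] at hi
      set s₁ := (s'.setNat x i).tick 1 with hs₁
      have h1 := hb ⟨i, hi⟩ s₁ ⟨fun y hy => by
        simp only [List.mem_cons, not_or] at hy
        simp only [hs₁, State.tick_nat, State.setNat_nat, hy.1, if_false]
        exact ha.nat y (by simp [Prog.nats, hy]), fun a h => by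
        simp only [List.mem_cons, not_or] at h
        exact ha.arr a (by simp [Prog.arrs, h])⟩ (by simp [hs₁])
      have hx' : (c.exec ω s₁).nat x = i := by
        rw [exec_nat_of_notMem hx]; simp [hs₁]
      have hd' : (c.exec ω s₁).arr dst = s'.arr dst := by
        rw [exec_arr_of_notMem hd]; simp [hs₁]
      intro j hj
      rw [exec_seq, exec_ite]
      by_cases hji : j = ⟨i, hi⟩
      · subst hji
        split_ifs with h2 h3 h3
        · simp [NExp.eval, RExp.eval, hx']
        · exact absurd (h1.1 h2) h3
        · exact absurd (h1.2 h3) h2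
        · simp [NExp.eval, RExp.eval, hx']
      · have hne : j.1 ≠ i := fun h => hji (Fin.ext h)
        have := hJ j (by omega)
        split_ifs with h2 h3 h3 <;> simpa [NExp.eval, hx', hne, hd', h3] using this)
  intro i
  exact this i (by simp [NExp.eval, hn])

/-- Write in the array `dst` the indicator of the first `r` elements of the set whose indicator is
the array `src`, where `r` is the variable `10`. -/
def pickLoop (src dst : ℕ) : Prog :=
  .seq (.setN 13 (.const 0)) (.loop 5 (.var 0)
    (.ite (.and (memTest src 5) (.leN (.add (.var 13) (.const 1)) (.var 10)))
      (.seq (.setR dst (.var 5) (.const 0) (.const 1)) (.setN 13 (.add (.var 13) (.const 1))))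
      (.setR dst (.var 5) (.const 0) (.const 0))))

theorem exec_pickLoop (ω : ℕ → ℝ) {src dst : ℕ} (s : State) (hn : s.nat 0 = n) (h : src ≠ dst)
    (S : Finset (Fin n)) (hS : s.Rep src S) (hr : s.nat 10 ≤ S.card) :
    ∃ A ⊆ S, A.card = s.nat 10 ∧ ((pickLoop src dst).exec ω s).Rep dst A := by
  rw [pickLoop, exec_seq]
  set s₁ := (Prog.setN 13 (.const 0)).exec ω s with hs₁
  have hn₁ : s₁.nat 0 = n := by simp [hs₁, hn]
  have hr₁ : s₁.nat 10 = s.nat 10 := by simp [hs₁]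
  have hS₁ : s₁.Rep src S := hS
  have := exec_loop_induction ω 5 (.var 0)
    (.ite (.and (memTest src 5) (.leN (.add (.var 13) (.const 1)) (.var 10)))
      (.seq (.setR dst (.var 5) (.const 0) (.const 1)) (.setN 13 (.add (.var 13) (.const 1))))
      (.setR dst (.var 5) (.const 0) (.const 0))) s₁
    -- The counter equals the minimum of r and the number of elements of S seen so far; with r ≤ |S|
    -- it ends at exactly r.
    (fun m s' => ∃ A ⊆ S.filter (fun i => i.1 < m), A.card = s'.nat 13 ∧
      s'.nat 13 = min (s.nat 10) (S.filter fun i => i.1 < m).card ∧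
      ∀ i : Fin n, i.1 < m → s'.arr dst i 0 = if i ∈ A then 1 else 0)
    ⟨∅, by simp, by simp [hs₁, NExp.eval], by simp [hs₁, NExp.eval], by simp⟩ ?_
  · obtain ⟨A, hA, hc, hm, hi⟩ := this
    have hfull : S.filter (fun i => i.1 < NExp.eval s₁ (.var 0)) = S := by
      simp [NExp.eval, hn₁]
    rw [hfull] at hA hm
    refine ⟨A, hA, by omega, fun i => hi i (by simp [NExp.eval, hn₁])⟩
  · rintro i hi s' ha ⟨A, hA, hc, hm, hJ⟩
    simp only [NExp.eval, hn₁] at hi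
    set v : Fin n := ⟨i, hi⟩ with hv
    have hvA : v ∉ A := fun hc => by simpa [hv] using hA hc
    set s₂ := (s'.setNat 5 i).tick 1 with hs₂
    have h5 : s₂.nat 5 = i := by simp [hs₂]
    have h13 : s₂.nat 13 = s'.nat 13 := by simp [hs₂]
    have h10 : s₂.nat 10 = s.nat 10 := by
      have := ha.nat 10 (by simp [Prog.nats])
      simp [hs₂, this, hr₁]
    have hS₂ : s₂.Rep src S := hS₁.of_arr_eq (ha.arr src (by simpa [Prog.arrs] using h))
    have harr : s₂.arr = s'.arr := rfl
    have hmem := hS₂.memTest_iff v h5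
    have hlt : ∀ j : Fin n, j.1 < i + 1 ↔ j.1 < i ∨ j = v := fun j => by
      rw [Fin.ext_iff]; simp only [hv]; omega
    have hsplit : S.filter (fun j => j.1 < i + 1) =
        if v ∈ S then insert v (S.filter fun j => j.1 < i) else S.filter fun j => j.1 < i := by
      ext j
      split_ifs with hvS
      · simp only [Finset.mem_filter, Finset.mem_insert, hlt]
        constructor
        · rintro ⟨h1, h2 | h2⟩
          · exact Or.inr ⟨h1, h2⟩
          · exact Or.inl h2
        · rintro (h1 | h1)
          · exact ⟨h1 ▸ hvS, Or.inr h1⟩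
          · exact ⟨h1.1, Or.inl h1.2⟩
      · simp only [Finset.mem_filter, hlt]
        constructor
        · rintro ⟨h1, h2 | h2⟩
          · exact ⟨h1, h2⟩
          · exact absurd (h2 ▸ h1) hvS
        · exact fun h1 => ⟨h1.1, Or.inl h1.2⟩
    have hcard : (S.filter fun j => j.1 < i + 1).card =
        (S.filter fun j => j.1 < i).card + if v ∈ S then 1 else 0 := by
      rw [hsplit]
      split_ifs
      · rw [Finset.card_insert_of_notMem (by simp [hv])]
      · rfl
    have hsub : S.filter (fun j => j.1 < i) ⊆ S.filter (fun j => j.1 < i + 1) := by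
      intro j hj
      simp only [Finset.mem_filter] at hj ⊢
      exact ⟨hj.1, by omega⟩
    rw [hcard]
    by_cases hb : (BExp.and (memTest src 5)
        (.leN (.add (.var 13) (.const 1)) (.var 10))).Holds s₂
    · rw [exec_ite_pos hb]
      simp only [BExp.Holds, hmem, NExp.eval, h13, h10] at hb
      refine ⟨insert v A, ?_, ?_, ?_, ?_⟩
      · refine Finset.insert_subset ?_ (hA.trans hsub)
        exact Finset.mem_filter.2 ⟨hb.1, Nat.lt_succ_self i⟩
      · simp [Finset.card_insert_of_notMem hvA, hc, NExp.eval, h13]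
      · simp only [exec_seq, exec_setR, exec_setN, State.tick_nat, State.setNat_nat, if_true,
          NExp.eval, State.setArr_nat, h13, hb.1]
        omega
      · intro j hj
        rcases (hlt j).1 hj with h1 | h1
        · have hne : j ≠ v := fun hh => by rw [hh] at h1; simp [hv] at h1
          have hne' : j.1 ≠ i := h1.ne
          simp [NExp.eval, h5, hne', hne, harr, hJ j h1]
        · subst h1
          simp [NExp.eval, RExp.eval, h5, hv]
    · rw [exec_ite_neg hb]
      simp only [BExp.Holds, hmem, NExp.eval, h13, h10, not_and] at hb
      refine ⟨A, hA.trans hsub, ?_, ?_, ?_⟩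
      · simp [hc, h13]
      · simp only [exec_setR, State.tick_nat, State.setArr_nat, h13]
        split_ifs with hvS
        · have := hb hvS
          omega
        · exact hm
      · intro j hj
        rcases (hlt j).1 hj with h1 | h1
        · have hne' : j.1 ≠ i := h1.ne
          simp [NExp.eval, h5, hne', harr, hJ j h1]
        · subst h1
          rw [if_neg hvA]
          simp [NExp.eval, RExp.eval, h5, hv]

/-! ### Greedy extraction succeeds -/

open Classical in
theorem numEdges_eq_sum (adj : Fin n → Fin n → Prop) (S T : Finset (Fin n)) :
    numEdges adj S T = ∑ i ∈ S, (T.filter fun j => adj i j).card := by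
  simp only [numEdges, Finset.card_filter, Finset.sum_product]

open Classical in
theorem numEdges_eq_sum_right (adj : Fin n → Fin n → Prop) (S T : Finset (Fin n)) :
    numEdges adj S T = ∑ j ∈ T, (S.filter fun i => adj i j).card := by
  simp only [numEdges, Finset.card_filter, Finset.sum_product_right]

theorem numNonedges_eq (adj : Fin n → Fin n → Prop) (S T : Finset (Fin n)) :
    numNonedges adj S T = numEdges (fun i j => ¬ adj i j) S T := by
  simp only [numNonedges, numEdges]
  congr!

open Classical in
theorem numEdges_erase_left (adj : Fin n → Fin n → Prop) (S T : Finset (Fin n)) {i : Fin n}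
    (hi : i ∈ S) :
    numEdges adj (S.erase i) T + (T.filter fun j => adj i j).card = numEdges adj S T := by
  rw [numEdges_eq_sum, numEdges_eq_sum, Finset.sum_erase_add _ _ hi]

open Classical in
theorem numEdges_erase_right (adj : Fin n → Fin n → Prop) (S T : Finset (Fin n)) {j : Fin n}
    (hj : j ∈ T) :
    numEdges adj S (T.erase j) + (S.filter fun i => adj i j).card = numEdges adj S T := by
  rw [numEdges_eq_sum_right, numEdges_eq_sum_right, Finset.sum_erase_add _ _ hj]

open Classical in
/-- Cleaning does not decrease `F - 2 r Q`. -/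
theorem CleanStep.density {adj : Fin n → Fin n → Prop} {r m : ℕ}
    {p q : Finset (Fin n) × Finset (Fin n)} (h : CleanStep adj r p q)
    (hp : m + 2 * r * numNonedges adj p.1 p.2 ≤ numEdges adj p.1 p.2) :
    m + 2 * r * numNonedges adj q.1 q.2 ≤ numEdges adj q.1 q.2 := by
  -- Non-edges are the edges of the complement, so one deletion identity serves both counts.
  -- Deleting a vertex removes its degree from F and its number of non-neighbours from Q, and the
  -- former is at most 2r times the latter.
  rw [numNonedges_eq] at hp ⊢
  cases h with
  | left S T i hi h =>
    have e1 := numEdges_erase_left adj S T hi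
    have e2 : numEdges (fun i j => ¬ adj i j) (S.erase i) T + (T.filter fun j => ¬ adj i j).card =
        numEdges (fun i j => ¬ adj i j) S T := by
      convert numEdges_erase_left (fun i j => ¬ adj i j) S T hi
    simp only at hp ⊢
    rw [← e1, ← e2, mul_add] at hp
    omega
  | right S T j hj h =>
    have e1 := numEdges_erase_right adj S T hj
    have e2 : numEdges (fun i j => ¬ adj i j) S (T.erase j) + (S.filter fun i => ¬ adj i j).card =
        numEdges (fun i j => ¬ adj i j) S T := by
      convert numEdges_erase_right (fun i j => ¬ adj i j) S T hj
    simp only at hp ⊢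
    rw [← e1, ← e2, mul_add] at hp
    omega

theorem density_of_reflTransGen {adj : Fin n → Fin n → Prop} {r m : ℕ}
    {p q : Finset (Fin n) × Finset (Fin n)} (h : Relation.ReflTransGen (CleanStep adj r) p q)
    (hp : m + 2 * r * numNonedges adj p.1 p.2 ≤ numEdges adj p.1 p.2) :
    m + 2 * r * numNonedges adj q.1 q.2 ≤ numEdges adj q.1 q.2 := by
  induction h with
  | refl => exact hp
  | tail _ h ih => exact h.density ih

open Classical in
theorem numEdges_le (adj : Fin n → Fin n → Prop) (S T : Finset (Fin n)) :
    numEdges adj S T ≤ S.card * T.card := by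
  rw [← Finset.card_product]
  exact Finset.card_filter_le _ _

/-- The number of edges is at most n times the size of either side, and the density condition makes
it at least 2nr. -/
theorem le_card_of_density {adj : Fin n → Fin n → Prop} {r : ℕ} {S T : Finset (Fin n)}
    (hn : 0 < n) (h : 2 * n * r + 2 * r * numNonedges adj S T ≤ numEdges adj S T) :
    2 * r ≤ S.card ∧ 2 * r ≤ T.card := by
  have h1 := numEdges_le adj S T
  have hS : S.card ≤ n := by simpa using Finset.card_le_univ S
  have hT : T.card ≤ n := by simpa using Finset.card_le_univ T
  constructor
  · refine Nat.le_of_mul_le_mul_left ?_ hn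
    calc n * (2 * r) = 2 * n * r := by ring
      _ ≤ S.card * T.card := by omega
      _ ≤ n * S.card := by rw [mul_comm]; exact Nat.mul_le_mul_right _ hT
  · refine Nat.le_of_mul_le_mul_left ?_ hn
    calc n * (2 * r) = 2 * n * r := by ring
      _ ≤ S.card * T.card := by omega
      _ ≤ n * T.card := Nat.mul_le_mul_right _ hS

open Classical in
/-- In a cleaned graph, any `r` vertices of `U` have at least `r` common neighbours. -/
theorem le_card_common {adj : Fin n → Fin n → Prop} {r : ℕ} {S T A : Finset (Fin n)}
    (hT : 2 * r ≤ T.card) (hfin : ∀ q, ¬ CleanStep adj r (S, T) q) (hA : A ⊆ S)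
    (hr : A.card = r) : r ≤ (T.filter fun j => ∀ i ∈ A, adj i j).card := by
  -- A vertex that cannot be deleted has degree above 2r times its number of non-neighbours, and its
  -- degree is at most |T|.
  have hnd : ∀ i ∈ A, 2 * r * (T.filter fun j => ¬ adj i j).card ≤ T.card := by
    intro i hi
    by_contra hc
    refine hfin _ (CleanStep.left S T i (hA hi) ?_)
    have := Finset.card_filter_le T (fun j => adj i j)
    omega
  have hcover : T ⊆ (T.filter fun j => ∀ i ∈ A, adj i j) ∪
      A.biUnion fun i => T.filter fun j => ¬ adj i j := by
    intro j hj
    by_cases h : ∀ i ∈ A, adj i j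
    · exact Finset.mem_union_left _ (Finset.mem_filter.2 ⟨hj, h⟩)
    · push Not at h
      obtain ⟨i, hi, hij⟩ := h
      exact Finset.mem_union_right _
        (Finset.mem_biUnion.2 ⟨i, hi, Finset.mem_filter.2 ⟨hj, hij⟩⟩)
  have h1 := (Finset.card_le_card hcover).trans (Finset.card_union_le _ _)
  have h2 : (A.biUnion fun i => T.filter fun j => ¬ adj i j).card ≤
      ∑ i ∈ A, (T.filter fun j => ¬ adj i j).card := Finset.card_biUnion_le
  rcases Nat.eq_zero_or_pos r with h0 | hpos
  · omega
  have h3 : 2 * r * ∑ i ∈ A, (T.filter fun j => ¬ adj i j).card ≤ r * T.card := by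
    rw [Finset.mul_sum]
    calc _ ≤ ∑ _i ∈ A, T.card := Finset.sum_le_sum hnd
      _ = r * T.card := by rw [Finset.sum_const, hr, smul_eq_mul]
  -- The r chosen vertices exclude at most half of T, and |T| ≥ 2r leaves r common neighbours.
  have h4 : 2 * ∑ i ∈ A, (T.filter fun j => ¬ adj i j).card ≤ T.card := by
    refine Nat.le_of_mul_le_mul_left ?_ hpos
    calc _ = 2 * r * ∑ i ∈ A, (T.filter fun j => ¬ adj i j).card := by ring
      _ ≤ _ := h3
  omega

theorem extractionParam_density (adj : Fin n → Fin n → Prop) (S T : Finset (Fin n)) :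
    2 * n * extractionParam adj S T + 2 * extractionParam adj S T * numNonedges adj S T ≤
      numEdges adj S T := by
  have := Nat.div_mul_le_self (numEdges adj S T) (2 * (n + numNonedges adj S T))
  calc _ = extractionParam adj S T * (2 * (n + numNonedges adj S T)) := by ring
    _ ≤ _ := this

/-- This is needed because `paramProg` finds the parameter by counting upwards through n iterations.
-/
theorem extractionParam_le (adj : Fin n → Fin n → Prop) (S T : Finset (Fin n)) :
    extractionParam adj S T ≤ n := by
  rcases Nat.eq_zero_or_pos n with h0 | hn
  · subst h0
    have : numEdges adj S T = 0 := by
      have h := numEdges_le adj S T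
      have : S.card = 0 := by simp [Finset.eq_empty_of_isEmpty S]
      simpa [this] using h
    simp [extractionParam, this]
  · have h := (le_card_of_density hn (extractionParam_density adj S T)).1
    have hS : S.card ≤ n := by simpa using Finset.card_le_univ S
    omega

/-- Every possible result of a round has `r` vertices on each side. -/
theorem Instance.RoundOutput.card_eq {I : Instance n d} {g : EuclideanSpace ℝ (Fin d)}
    {A B : Finset (Fin n)} (h : I.RoundOutput g A B) :
    A.card = extractionParam I.adj (I.survU g) (I.survV g) ∧ IsBalancedBiclique I.adj A B := by
  rcases h with ⟨h0, rfl, rfl⟩ | ⟨_, S, T, _, _, _, hA, _, hB, h⟩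
  · simp [h0, IsBalancedBiclique]
  · exact ⟨hA, hA.trans hB.symm, fun i hi j hj => h j hj i hi⟩

/-! ### The rounding program -/

/-- The memory holds the input `I`. -/
structure State.Holding (I : Instance n d) (s : State) : Prop where
  n_eq : s.nat 0 = n
  d_eq : s.nat 1 = d
  adj_iff : ∀ i j : Fin n, s.arr 0 i j = 1 ∧ I.adj i j ∨ s.arr 0 i j = 0 ∧ ¬ I.adj i j
  u_eq : ∀ (i : Fin n) (a : Fin d), s.arr 1 i a = I.u i a
  v_eq : ∀ (i : Fin n) (a : Fin d), s.arr 2 i a = I.v i a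
  e_eq : ∀ a : Fin d, s.arr 3 0 a = I.e a
  k_eq : s.arr 4 0 0 = I.k

theorem Instance.input_holding (I : Instance n d) : I.input.Holding I where
  n_eq := rfl
  d_eq := rfl
  adj_iff i j := by by_cases h : I.adj i j <;> simp [Instance.input, h]
  u_eq i a := by simp [Instance.input]
  v_eq i a := by simp [Instance.input]
  e_eq a := by simp [Instance.input]
  k_eq := by simp [Instance.input]

theorem State.Holding.of_agree {I : Instance n d} {s s' : State} {xs as : List ℕ}
    (h : s.Holding I) (ha : s.Agree xs as s') (hx : ∀ x < 2, x ∉ xs) (has : ∀ a < 5, a ∉ as) :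
    s'.Holding I where
  n_eq := (ha.nat 0 (hx 0 (by norm_num))).trans h.n_eq
  d_eq := (ha.nat 1 (hx 1 (by norm_num))).trans h.d_eq
  adj_iff i j := by rw [ha.arr 0 (has 0 (by norm_num))]; exact h.adj_iff i j
  u_eq i a := by rw [ha.arr 1 (has 1 (by norm_num))]; exact h.u_eq i a
  v_eq i a := by rw [ha.arr 2 (has 2 (by norm_num))]; exact h.v_eq i a
  e_eq a := by rw [ha.arr 3 (has 3 (by norm_num))]; exact h.e_eq a
  k_eq := by rw [ha.arr 4 (has 4 (by norm_num))]; exact h.k_eq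

theorem State.Holding.exec {I : Instance n d} {s : State} (h : s.Holding I) (ω : ℕ → ℝ) (c : Prog)
    (hx : ∀ x < 2, x ∉ c.nats) (has : ∀ a < 5, a ∉ c.arrs) : (c.exec ω s).Holding I :=
  h.of_agree (exec_agree ω c s) hx has

theorem State.Holding.adjTest_iff {I : Instance n d} {s : State} (h : s.Holding I) {x y : ℕ}
    (i j : Fin n) (hi : s.nat x = i) (hj : s.nat y = j) : (adjTest x y).Holds s ↔ I.adj i j := by
  simp only [adjTest, BExp.Holds, RExp.eval, NExp.eval, hi, hj]
  rcases h.adj_iff i j with ⟨h1, h2⟩ | ⟨h1, h2⟩ <;> simp [h1, h2]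

@[simp] theorem sumLoop_nats (x : ℕ) (p : NExp) (a : ℕ) (e : RExp) :
    (sumLoop x p a e).nats = [x] := rfl

@[simp] theorem sumLoop_arrs (x : ℕ) (p : NExp) (a : ℕ) (e : RExp) :
    (sumLoop x p a e).arrs = [a, a] := rfl

@[simp] theorem countLoop_nats (x dst : ℕ) (b : BExp) : (countLoop x dst b).nats = [x, dst] := rfl

@[simp] theorem countLoop_arrs (x dst : ℕ) (b : BExp) : (countLoop x dst b).arrs = [] := rfl

/-! ### Sampling a vector and thresholding the vertices. -/

/-- Draw the vector `g` into the row `0` of the array `7`. -/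
def drawProg : Prog := .loop 7 (.var 1) (.gauss 7 (.const 0) (.var 7))

theorem exec_drawProg (ω : ℕ → ℝ) (s : State) (hd : s.nat 1 = d) :
    (∀ a : Fin d, (drawProg.exec ω s).arr 7 0 a = ω (s.drawn + a)) ∧
      (drawProg.exec ω s).drawn = s.drawn + d := by
  have := exec_loop_induction ω 7 (.var 1) (.gauss 7 (.const 0) (.var 7)) s
    (fun m s' => (∀ a : ℕ, a < m → s'.arr 7 0 a = ω (s.drawn + a)) ∧ s'.drawn = s.drawn + m)
    (by simp) (by
      rintro i - s' - ⟨h1, h2⟩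
      refine ⟨fun a ha => ?_, ?_⟩
      · by_cases hai : a = i
        · subst hai
          simp [Prog.exec, NExp.eval, h2]
        · simpa [Prog.exec, NExp.eval, hai] using h1 a (by omega)
      · simp [Prog.exec, h2, add_assoc])
  simp only [NExp.eval, hd] at this
  exact ⟨fun a => this.1 a a.2, this.2⟩

/-- The coordinate of the shifted vector. -/
def shiftExp (src : ℕ) : RExp :=
  .sub (.get src (.var 5) (.var 6))
    (.mul (.mul (.sub (.const 1) (.div (.const 1) (.sqrt (.const 2))))
      (.get 12 (.const 0) (.const 0))) (.get 3 (.const 0) (.var 6)))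

/-- The inner products that decide whether a vertex survives. -/
def innerProg (src : ℕ) : Prog :=
  .seq (sumLoop 6 (.var 1) 12 (.mul (.get src (.var 5) (.var 6)) (.get 3 (.const 0) (.var 6))))
    (.seq (sumLoop 6 (.var 1) 13 (.mul (shiftExp src) (shiftExp src)))
      (sumLoop 6 (.var 1) 14 (.mul (.get 7 (.const 0) (.var 6)) (shiftExp src))))

@[simp] theorem innerProg_nats (src : ℕ) : (innerProg src).nats = [6, 6, 6] := rfl

@[simp] theorem innerProg_arrs (src : ℕ) : (innerProg src).arrs = [12, 12, 13, 13, 14, 14] := rfl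

/-- The test of whether a vertex survives. -/
def surviveTest : BExp :=
  .and (.leR (.div (.const 1) (.mul (.const 8) (.div (.ofN (.var 0)) (.get 4 (.const 0) (.const 0)))))
      (.get 12 (.const 0) (.const 0)))
    (.leR (.sqrt (.mul (.div (.const 1) (.const 10)) (.log (.ofN (.var 0)))))
      (.mul (.div (.const 1) (.sqrt (.get 13 (.const 0) (.const 0))))
        (.get 14 (.const 0) (.const 0))))

theorem inner_eq_sum (x y : EuclideanSpace ℝ (Fin d)) : inner ℝ x y = ∑ a, x a * y a := by
  simp [PiLp.inner_apply, mul_comm]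

/-- The program stores ‖w'‖² and divides ⟨g, w'⟩ by its square root. If w' = 0, or if k = 0 in the
threshold, division by zero has value zero on both sides, so the equivalence needs no nondegeneracy.
-/
theorem surviveTest_iff (ω : ℕ → ℝ) (I : Instance n d) (g : EuclideanSpace ℝ (Fin d)) {src : ℕ}
    (hsrc : src < 5) {s : State} (hs : s.Holding I) (hg : ∀ a : Fin d, s.arr 7 0 a = g a)
    (i : Fin n) (hi : s.nat 5 = i) (w : EuclideanSpace ℝ (Fin d))
    (hw : ∀ a : Fin d, s.arr src i a = w a) :
    surviveTest.Holds ((innerProg src).exec ω s) ↔ I.Survives g w := by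
  rw [innerProg, exec_seq, exec_seq]
  set c₁ := sumLoop 6 (.var 1) 12
    (.mul (.get src (.var 5) (.var 6)) (.get 3 (.const 0) (.var 6))) with hc₁
  set c₂ := sumLoop 6 (.var 1) 13 (.mul (shiftExp src) (shiftExp src)) with hc₂
  set c₃ := sumLoop 6 (.var 1) 14 (.mul (.get 7 (.const 0) (.var 6)) (shiftExp src)) with hc₃
  have a₁ : s.Agree [6] [12] (c₁.exec ω s) :=
    (exec_agree ω c₁ s).mono (by simp [hc₁]) (by simp [hc₁])
  have a₂ : (c₁.exec ω s).Agree [6] [13] (c₂.exec ω (c₁.exec ω s)) :=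
    (exec_agree ω c₂ _).mono (by simp [hc₂]) (by simp [hc₂])
  have a₃ : (c₂.exec ω (c₁.exec ω s)).Agree [6] [14] (c₃.exec ω (c₂.exec ω (c₁.exec ω s))) :=
    (exec_agree ω c₃ _).mono (by simp [hc₃]) (by simp [hc₃])
  have a₁₂ := (a₁.mono (List.Subset.refl _) (as' := [12, 13, 14]) (by simp)).trans
    (a₂.mono (List.Subset.refl _) (by simp))
  have a₁₃ := a₁₂.trans (a₃.mono (List.Subset.refl _) (by simp))
  have e₁ : (c₁.exec ω s).arr 12 0 0 = inner ℝ w I.e := by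
    rw [inner_eq_sum]
    refine exec_sumLoop ω _ s (fun s' h => by simp [NExp.eval, h, hs.d_eq]) _ ?_
    intro a s' h1 h2 h3
    simp [RExp.eval, NExp.eval, h2, h1 5, hi, h3 src (by omega), h3 3, hw, hs.e_eq]
  have hsh : ∀ a : Fin d, w a - (1 - 1 / √2) * inner ℝ w I.e * I.e a = I.shift w a := by
    intro a; simp [Instance.shift]
  have e₂ : (c₂.exec ω (c₁.exec ω s)).arr 13 0 0 = ‖I.shift w‖ ^ 2 := by
    rw [← real_inner_self_eq_norm_sq, inner_eq_sum]
    refine exec_sumLoop ω _ _ (fun s' h => by simp [NExp.eval, h, a₁.nat 1, hs.d_eq]) _ ?_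
    intro a s' h1 h2 h3
    simp only [shiftExp, RExp.eval, NExp.eval, h2, h1 5 (by norm_num), a₁.nat 5 (by simp), hi,
      h3 src (by omega), h3 3 (by norm_num), h3 12 (by norm_num), e₁,
      a₁.arr src (by simp; omega), a₁.arr 3 (by simp), hw, hs.e_eq, ← hsh]
    norm_num
  have e₃ : (c₃.exec ω (c₂.exec ω (c₁.exec ω s))).arr 14 0 0 = inner ℝ g (I.shift w) := by
    rw [inner_eq_sum]
    refine exec_sumLoop ω _ _ (fun s' h => by simp [NExp.eval, h, a₁₂.nat 1, hs.d_eq]) _ ?_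
    intro a s' h1 h2 h3
    simp only [shiftExp, RExp.eval, NExp.eval, h2, h1 5 (by norm_num), a₁₂.nat 5 (by simp), hi,
      h3 src (by omega), h3 3 (by norm_num), h3 12 (by norm_num), h3 7 (by norm_num), e₁,
      a₂.arr 12 (by simp), hg,
      a₁₂.arr src (by simp; omega), a₁₂.arr 3 (by simp), a₁₂.arr 7 (by simp), hw, hs.e_eq, ← hsh]
    norm_num
  simp only [surviveTest, BExp.Holds, RExp.eval, NExp.eval, e₃, a₃.arr 13 (by simp), e₂,
    a₃.arr 12 (by simp), a₂.arr 12 (by simp), e₁, a₁₃.nat 0 (by simp), a₁₃.arr 4 (by simp),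
    hs.n_eq, hs.k_eq, Instance.Survives, Instance.t, inner_smul_right,
    Real.sqrt_sq (norm_nonneg _)]
  norm_num

/-- Write in the array `dst` the indicator of the surviving vertices. -/
def surviveProg (src dst : ℕ) : Prog := markLoop 5 dst (innerProg src) surviveTest

open Classical in
theorem exec_surviveProg (ω : ℕ → ℝ) (I : Instance n d) (g : EuclideanSpace ℝ (Fin d))
    {src dst : ℕ} (hsrc : src < 5) (hd : 7 < dst ∧ dst < 12) {s : State} (hs : s.Holding I)
    (hg : ∀ a : Fin d, s.arr 7 0 a = g a) (w : Fin n → EuclideanSpace ℝ (Fin d))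
    (hw : ∀ (i : Fin n) (a : Fin d), s.arr src i a = w i a) :
    ((surviveProg src dst).exec ω s).Rep dst
      (Finset.univ.filter fun i => I.Survives g (w i)) := by
  refine exec_markLoop ω _ _ s hs.n_eq (by simp) ?_ _ ?_
  · simp; omega
  · intro i s' ha hi
    have ha' : s.Agree [5, 6] [dst, 12, 13, 14] s' := ha.mono (by simp) (by simp)
    have hs' : s'.Holding I := hs.of_agree ha' (by simp; omega) (by simp; omega)
    rw [surviveTest_iff ω I g hsrc hs' (fun a => by rw [ha'.arr 7 (by simp; omega), hg]) i hi (w i)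
      (fun a => by rw [ha'.arr src (by simp; omega), hw])]
    simp

/-! ### Counting edges and computing the extraction parameter. -/

/-- Count the pairs in the sets with indicators in the arrays `8`, `9` that pass the test. -/
def pairCount (dst : ℕ) (b : BExp) : Prog :=
  .seq (.setN dst (.const 0))
    (.loop 5 (.var 0) (countLoop 6 dst (.and (.and (memTest 8 5) (memTest 9 6)) b)))

open Classical in
theorem exec_pairCount (ω : ℕ → ℝ) (I : Instance n d) {dst : ℕ} (hdst : 6 < dst) (b : BExp)
    {s : State} (hs : s.Holding I) (S T : Finset (Fin n)) (hS : s.Rep 8 S) (hT : s.Rep 9 T)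
    (R : Fin n → Fin n → Prop)
    (hb : ∀ (i j : Fin n) (s' : State), s'.Holding I → s'.nat 5 = i → s'.nat 6 = j →
      (b.Holds s' ↔ R i j)) :
    ((pairCount dst b).exec ω s).nat dst = numEdges R S T := by
  rw [pairCount, exec_seq]
  set s₁ := (Prog.setN dst (.const 0)).exec ω s with hs₁
  have hh₁ : s₁.Holding I := hs.exec ω _ (by simp [Prog.nats]; omega) (by simp [Prog.arrs])
  rw [exec_loop_nat_sum ω 5 dst _ _ s₁ (fun i => if h : i < n then
    (Finset.univ.filter fun j : Fin n => (⟨i, h⟩ ∈ S ∧ j ∈ T) ∧ R ⟨i, h⟩ j).card else 0)]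
  · simp only [NExp.eval, hh₁.n_eq]
    rw [Finset.sum_range, numEdges_eq_sum, ← Finset.sum_subset (Finset.subset_univ S)]
    · have : s₁.nat dst = 0 := by simp [hs₁, NExp.eval]
      rw [this, zero_add]
      refine Finset.sum_congr rfl fun i hi => ?_
      simp only [i.2, dif_pos, hi, true_and]
      congr 1
      ext j
      simp
    · intro i _ hi
      simp [hi]
  · intro i hi s' ha
    simp only [NExp.eval, hh₁.n_eq] at hi
    simp only [hi, dif_pos]
    have hh' : ((s'.setNat 5 i).tick 1).Holding I := by
      have := hh₁.of_agree ha (by simp [countLoop, Prog.nats]; omega)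
        (by simp [countLoop, Prog.arrs])
      exact ⟨this.n_eq, this.d_eq, this.adj_iff, this.u_eq, this.v_eq, this.e_eq, this.k_eq⟩
    rw [exec_countLoop ω _ ((s'.setNat 5 i).tick 1) hh'.n_eq (by omega)
      (fun j => (⟨i, hi⟩ ∈ S ∧ j ∈ T) ∧ R ⟨i, hi⟩ j)]
    · have : dst ≠ 5 := by omega
      simp only [State.tick_nat, State.setNat_nat, this, if_false]
      congr!
    · intro j s'' h1 h2 h3
      have h5 : s''.nat 5 = i := by rw [h1 5 (by norm_num) (by omega)]; simp
      have arr_eq : ∀ a, s''.arr a = s.arr a := fun a => by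
        rw [h3]
        exact ha.arr a (by simp [countLoop, Prog.arrs])
      have hh'' : s''.Holding I := hh'.of_agree (xs := [6, dst]) (as := [])
        ⟨fun y hy => by simp at hy; exact h1 y hy.1 hy.2, fun a _ => by rw [h3]⟩
        (by simp; omega) (by simp)
      have m1 := (hS.of_arr_eq (arr_eq 8)).memTest_iff ⟨i, hi⟩ h5
      have m2 := (hT.of_arr_eq (arr_eq 9)).memTest_iff j h2
      have m3 := hb ⟨i, hi⟩ j s'' hh'' h5 h2
      simp only [BExp.Holds, m1, m2, m3]

/-- Compute the parameter of the extraction. -/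
def paramProg : Prog :=
  .seq (.setN 10 (.const 0)) (.loop 5 (.var 0)
    (.ite (.leR (.mul (.ofN (.add (.var 10) (.const 1)))
        (.mul (.const 2) (.ofN (.add (.var 0) (.var 9))))) (.ofN (.var 8)))
      (.setN 10 (.add (.var 10) (.const 1))) .skip))

/-- The quotient is found by raising r while (r + 1) · 2(n + Q) ≤ F. The product is formed in real
arithmetic, since integer expressions have no multiplication. -/
theorem exec_paramProg (ω : ℕ → ℝ) (s : State) (hn : s.nat 0 = n) (hpos : 0 < n)
    (hle : s.nat 8 / (2 * (n + s.nat 9)) ≤ n) :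
    (paramProg.exec ω s).nat 10 = s.nat 8 / (2 * (n + s.nat 9)) := by
  rw [paramProg, exec_seq]
  set s₁ := (Prog.setN 10 (.const 0)).exec ω s with hs₁
  have hn₁ : s₁.nat 0 = n := by simp [hs₁, hn]
  have := exec_loop_induction ω 5 (.var 0)
    (.ite (.leR (.mul (.ofN (.add (.var 10) (.const 1)))
        (.mul (.const 2) (.ofN (.add (.var 0) (.var 9))))) (.ofN (.var 8)))
      (.setN 10 (.add (.var 10) (.const 1))) .skip) s₁
    (fun m s' => s'.nat 10 = min m (s.nat 8 / (2 * (n + s.nat 9))))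
    (by simp [hs₁, NExp.eval]) (by
      intro i hi s' ha hJ
      have h0 : s'.nat 0 = n := (ha.nat 0 (by simp [Prog.nats])).trans hn₁
      have h8 : s'.nat 8 = s.nat 8 := (ha.nat 8 (by simp [Prog.nats])).trans (by simp [hs₁])
      have h9 : s'.nat 9 = s.nat 9 := (ha.nat 9 (by simp [Prog.nats])).trans (by simp [hs₁])
      have key : (BExp.leR (.mul (.ofN (.add (.var 10) (.const 1)))
          (.mul (.const 2) (.ofN (.add (.var 0) (.var 9))))) (.ofN (.var 8))).Holds
          ((s'.setNat 5 i).tick 1) ↔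
          s'.nat 10 + 1 ≤ s.nat 8 / (2 * (n + s.nat 9)) := by
        rw [Nat.le_div_iff_mul_le (by omega)]
        simp only [BExp.Holds, RExp.eval, NExp.eval, State.tick_nat, State.setNat_nat, h8, h9, h0]
        norm_num
        norm_cast
      rw [exec_ite]
      split_ifs with h
      · rw [key] at h
        simp [NExp.eval]
        omega
      · rw [key] at h
        simp
        omega)
  rw [this]
  simp only [NExp.eval, hn₁]
  omega

/-! ### The cleaning loop and its termination. -/

theorem State.Holding.tick_setNat {I : Instance n d} {s : State} (h : s.Holding I) {x : ℕ}
    (hx : 2 ≤ x) (c m : ℕ) : ((s.setNat x c).tick m).Holding I :=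
  h.of_agree (xs := [x]) (as := [])
    ⟨fun y hy => by simp at hy; simp [hy], fun _ _ => rfl⟩ (by simp; omega) (by simp)

/-- Visit the vertices of one side, whose current set is the array `S`, and delete those whose degree
into the current set `T` of the other side is at most `2 r` times the number of non-neighbours. -/
def sweep (S T : ℕ) (b : BExp) : Prog :=
  .loop 5 (.var 0)
    (.seq (.setN 11 (.const 0)) (.seq (countLoop 6 11 (.and (memTest T 6) b))
      (.seq (.setN 12 (.const 0)) (.seq (countLoop 6 12 (.and (memTest T 6) (.not b)))
        (.ite (.and (memTest S 5) (.leR (.ofN (.var 11))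
            (.mul (.mul (.const 2) (.ofN (.var 10))) (.ofN (.var 12)))))
          (.setR S (.var 5) (.const 0) (.const 0)) .skip)))))

@[simp] theorem sweep_nats (S T : ℕ) (b : BExp) :
    (sweep S T b).nats = [5, 11, 6, 11, 12, 6, 12] := rfl

@[simp] theorem sweep_arrs (S T : ℕ) (b : BExp) : (sweep S T b).arrs = [S] := rfl

open Classical in
/-- The vertex `i` of one side, with adjacency `R` to the set `T` of the other side, is to be deleted
in the cleaning with parameter `r`. -/
def Deletable (R : Fin n → Fin n → Prop) (r : ℕ) (T : Finset (Fin n)) (i : Fin n) : Prop :=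
  (T.filter fun j => R i j).card ≤ 2 * r * (T.filter fun j => ¬ R i j).card

/-- Deletion of one vertex of one side. -/
inductive DeleteStep (R : Fin n → Fin n → Prop) (r : ℕ) (T : Finset (Fin n)) :
    Finset (Fin n) → Finset (Fin n) → Prop
  | intro (S : Finset (Fin n)) (i : Fin n) (hi : i ∈ S) (h : Deletable R r T i) :
      DeleteStep R r T S (S.erase i)

theorem DeleteStep.subset {R : Fin n → Fin n → Prop} {r : ℕ} {T S S' : Finset (Fin n)}
    (h : Relation.ReflTransGen (DeleteStep R r T) S S') : S' ⊆ S := by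
  induction h with
  | refl => exact Finset.Subset.refl _
  | tail _ h ih =>
    cases h with
    | intro i hi h => exact (Finset.erase_subset _ _).trans ih

theorem DeleteStep.eq_or_card_lt {R : Fin n → Fin n → Prop} {r : ℕ} {T S S' : Finset (Fin n)}
    (h : Relation.ReflTransGen (DeleteStep R r T) S S') : S' = S ∨ S'.card < S.card := by
  rcases (DeleteStep.subset h).eq_or_ssubset with h | h
  · exact Or.inl h
  · exact Or.inr (Finset.card_lt_card h)

theorem DeleteStep.left {adj : Fin n → Fin n → Prop} {r : ℕ} {T S S' : Finset (Fin n)}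
    (h : Relation.ReflTransGen (DeleteStep adj r T) S S') :
    Relation.ReflTransGen (CleanStep adj r) (S, T) (S', T) := by
  induction h with
  | refl => exact .refl
  | tail _ h ih =>
    cases h with
    | intro i hi h => exact ih.tail (CleanStep.left _ T i hi h)

theorem DeleteStep.right {adj : Fin n → Fin n → Prop} {r : ℕ} {S T T' : Finset (Fin n)}
    (h : Relation.ReflTransGen (DeleteStep (fun j i => adj i j) r S) T T') :
    Relation.ReflTransGen (CleanStep adj r) (S, T) (S, T') := by
  induction h with
  | refl => exact .refl
  | tail _ h ih =>
    cases h with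
    | intro j hj h => exact ih.tail (CleanStep.right S _ j hj h)

theorem not_cleanStep {adj : Fin n → Fin n → Prop} {r : ℕ} {S T : Finset (Fin n)}
    (hS : ∀ i ∈ S, ¬ Deletable adj r T i) (hT : ∀ j ∈ T, ¬ Deletable (fun j i => adj i j) r S j)
    (q : Finset (Fin n) × Finset (Fin n)) : ¬ CleanStep adj r (S, T) q := by
  intro h
  cases h with
  | left S T i hi h => exact hS i hi h
  | right S T j hj h => exact hT j hj h

-- The opposite side `T` is fixed during the sweep, so whether a vertex is deletable does not change
-- while other vertices of its side are removed. Hence a sweep that changes nothing certifies that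
-- its whole side is stable.
open Classical in
theorem exec_sweep (ω : ℕ → ℝ) (I : Instance n d) {aS aT : ℕ} (hSa : 5 ≤ aS)
    (hne : aS ≠ aT) (b : BExp)
    {s : State} (hs : s.Holding I) (S T : Finset (Fin n)) (hS : s.Rep aS S) (hT : s.Rep aT T)
    (R : Fin n → Fin n → Prop)
    (hb : ∀ (i j : Fin n) (s' : State), s'.Holding I → s'.nat 5 = i → s'.nat 6 = j →
      (b.Holds s' ↔ R i j)) :
    ∃ S', ((sweep aS aT b).exec ω s).Rep aS S' ∧
      Relation.ReflTransGen (DeleteStep R (s.nat 10) T) S S' ∧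
      (S' = S → ∀ i ∈ S, ¬ Deletable R (s.nat 10) T i) := by
  set body : Prog := .seq (.setN 11 (.const 0)) (.seq (countLoop 6 11 (.and (memTest aT 6) b))
      (.seq (.setN 12 (.const 0)) (.seq (countLoop 6 12 (.and (memTest aT 6) (.not b)))
        (.ite (.and (memTest aS 5) (.leR (.ofN (.var 11))
            (.mul (.mul (.const 2) (.ofN (.var 10))) (.ofN (.var 12)))))
          (.setR aS (.var 5) (.const 0) (.const 0)) .skip)))) with hbody
  have hbn : body.nats = [11, 6, 11, 12, 6, 12] := rfl
  have hba : body.arrs = [aS] := rfl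
  have := exec_loop_induction ω 5 (.var 0) body s (fun m s' => ∃ S', s'.Rep aS S' ∧
      Relation.ReflTransGen (DeleteStep R (s.nat 10) T) S S' ∧
      (S' = S → ∀ i ∈ S, i.1 < m → ¬ Deletable R (s.nat 10) T i))
    ⟨S, hS, Relation.ReflTransGen.refl, by simp⟩ (by
      rintro i hi s' ha ⟨S', hS', hrt, hdel⟩
      simp only [NExp.eval, hs.n_eq] at hi
      set v : Fin n := ⟨i, hi⟩ with hv
      rw [hbn, hba] at ha
      have hs' : s'.Holding I := hs.of_agree ha (by simp; omega) (by simp; omega)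
      set s₀ := (s'.setNat 5 i).tick 1 with hs₀
      have hh₀ : s₀.Holding I := hs'.tick_setNat (by norm_num) _ _
      set s₁ := (Prog.setN 11 (.const 0)).exec ω s₀ with hs₁
      have hh₁ : s₁.Holding I := hh₀.tick_setNat (by norm_num) _ _
      set c₁ := countLoop 6 11 (.and (memTest aT 6) b) with hc₁
      set s₂ := c₁.exec ω s₁ with hs₂
      have a₂ : s₁.Agree [6, 11] [] s₂ :=
        (exec_agree ω c₁ s₁).mono (by simp [hc₁]) (by simp [hc₁])
      have hh₂ : s₂.Holding I := hh₁.of_agree a₂ (by simp; omega) (by simp)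
      set s₃ := (Prog.setN 12 (.const 0)).exec ω s₂ with hs₃
      have hh₃ : s₃.Holding I := hh₂.tick_setNat (by norm_num) _ _
      set c₂ := countLoop 6 12 (.and (memTest aT 6) (.not b)) with hc₂
      set s₄ := c₂.exec ω s₃ with hs₄
      have a₄ : s₃.Agree [6, 12] [] s₄ :=
        (exec_agree ω c₂ s₃).mono (by simp [hc₂]) (by simp [hc₂])
      have arr₁ : s₁.arr = s'.arr := rfl
      have arr₃ : s₃.arr = s'.arr := by
        ext a : 1
        exact a₂.arr a (by simp)
      have arr₄ : s₄.arr = s'.arr := by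
        ext a : 1
        exact (a₄.arr a (by simp)).trans (congrFun arr₃ a)
      have five₁ : s₁.nat 5 = v := by simp [hs₁, hs₀, hv]
      have five₃ : s₃.nat 5 = v := by
        have := a₂.nat 5 (by simp)
        simp [hs₃, this, five₁]
      have five₄ : s₄.nat 5 = v := (a₄.nat 5 (by simp)).trans five₃
      have ten : s₄.nat 10 = s.nat 10 := by
        rw [a₄.nat 10 (by simp)]
        have h1 := a₂.nat 10 (by simp)
        have h2 := ha.nat 10 (by simp)
        simp [hs₃, h1, hs₁, hs₀, h2]
      have hT' : s'.Rep aT T := hT.of_arr_eq (ha.arr aT (by simpa using hne.symm))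
      have count₁ : s₂.nat 11 = (T.filter fun j => R v j).card := by
        rw [hs₂, exec_countLoop ω _ s₁ hh₁.n_eq (by norm_num) (fun j => j ∈ T ∧ R v j)]
        · have : s₁.nat 11 = 0 := by simp [hs₁, NExp.eval]
          rw [this, zero_add]
          congr 1
          ext j
          simp
        · intro j s'' h1 h2 h3
          have hh : s''.Holding I := hh₁.of_agree (xs := [6, 11]) (as := [])
            ⟨fun y hy => by simp at hy; exact h1 y hy.1 hy.2, fun a _ => by rw [h3]⟩
            (by simp; omega) (by simp)
          have m1 := (hT'.of_arr_eq (s' := s'') (by rw [h3, arr₁])).memTest_iff j h2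
          have m2 := hb v j s'' hh (by rw [h1 5 (by norm_num) (by norm_num), five₁]) h2
          simp only [BExp.Holds, m1, m2]
      have count₂ : s₄.nat 12 = (T.filter fun j => ¬ R v j).card := by
        rw [hs₄, exec_countLoop ω _ s₃ hh₃.n_eq (by norm_num) (fun j => j ∈ T ∧ ¬ R v j)]
        · have : s₃.nat 12 = 0 := by simp [hs₃, NExp.eval]
          rw [this, zero_add]
          congr 1
          ext j
          simp
        · intro j s'' h1 h2 h3
          have hh : s''.Holding I := hh₃.of_agree (xs := [6, 12]) (as := [])
            ⟨fun y hy => by simp at hy; exact h1 y hy.1 hy.2, fun a _ => by rw [h3]⟩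
            (by simp; omega) (by simp)
          have m1 := (hT'.of_arr_eq (s' := s'') (by rw [h3, arr₃])).memTest_iff j h2
          have m2 := hb v j s'' hh (by rw [h1 5 (by norm_num) (by norm_num), five₃]) h2
          simp only [BExp.Holds, m1, m2]
      have count₁' : s₄.nat 11 = (T.filter fun j => R v j).card := by
        rw [← count₁, a₄.nat 11 (by simp)]
        simp [hs₃]
      have htest : (BExp.and (memTest aS 5) (.leR (.ofN (.var 11))
          (.mul (.mul (.const 2) (.ofN (.var 10))) (.ofN (.var 12))))).Holds s₄ ↔
          v ∈ S' ∧ Deletable R (s.nat 10) T v := by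
        have m1 := (hS'.of_arr_eq (s' := s₄) (by rw [arr₄])).memTest_iff v five₄
        simp only [BExp.Holds, m1, RExp.eval, NExp.eval, count₁', count₂, ten, Deletable]
        norm_num
        norm_cast
        simp
      have hexec : body.exec ω s₀ = (Prog.ite (.and (memTest aS 5) (.leR (.ofN (.var 11))
            (.mul (.mul (.const 2) (.ofN (.var 10))) (.ofN (.var 12)))))
          (.setR aS (.var 5) (.const 0) (.const 0)) .skip).exec ω s₄ := rfl
      rw [hexec]
      by_cases h : v ∈ S' ∧ Deletable R (s.nat 10) T v
      · rw [exec_ite_pos (htest.2 h)]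
        refine ⟨S'.erase v, ?_, hrt.tail (DeleteStep.intro S' v h.1 h.2), ?_⟩
        · intro j
          by_cases hj : j = v
          · subst hj
            simp [NExp.eval, RExp.eval, five₄]
          · have : j.1 ≠ v.1 := fun h => hj (Fin.ext h)
            simp [NExp.eval, five₄, this, hj, arr₄, hS' j]
        -- After a deletion the set is strictly smaller than S, so the stability clause is vacuous.
        · intro he
          exfalso
          have := DeleteStep.subset hrt h.1
          rw [← he] at this
          simp at this
      · rw [exec_ite_neg (fun hc => h (htest.1 hc))]
        refine ⟨S', hS'.of_arr_eq (by simp [arr₄]), hrt, ?_⟩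
        intro he j hj hji hjd
        by_cases hjv : j = v
        · subst hjv
          exact h ⟨he ▸ hj, hjd⟩
        · have : j.1 ≠ i := fun h => hjv (Fin.ext h)
          exact hdel he j hj (by omega) hjd)
  obtain ⟨S', h1, h2, h3⟩ := this
  exact ⟨S', h1, h2, fun he i hi => h3 he i hi (by simp [NExp.eval, hs.n_eq])⟩

/-- Visit all vertices once. -/
def passProg : Prog := .seq (sweep 8 9 (adjTest 5 6)) (sweep 9 8 (adjTest 6 5))

/-- If neither sweep deletes anything, the second one tested against the original S, so both sides
are stable at the same time. -/
theorem exec_passProg (ω : ℕ → ℝ) (I : Instance n d) {s : State} (hs : s.Holding I)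
    (S T : Finset (Fin n)) (hS : s.Rep 8 S) (hT : s.Rep 9 T) :
    ∃ S' T', (passProg.exec ω s).Rep 8 S' ∧ (passProg.exec ω s).Rep 9 T' ∧
      Relation.ReflTransGen (CleanStep I.adj (s.nat 10)) (S, T) (S', T') ∧
      (S'.card + T'.card < S.card + T.card ∨
        S' = S ∧ T' = T ∧ ∀ q, ¬ CleanStep I.adj (s.nat 10) (S, T) q) := by
  obtain ⟨S', hS', hrS, hfS⟩ := exec_sweep ω I (aS := 8) (aT := 9) (by norm_num)
    (by norm_num) (adjTest 5 6) hs S T hS hT I.adj (fun i j s' h h1 h2 => h.adjTest_iff i j h1 h2)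
  set s₁ := (sweep 8 9 (adjTest 5 6)).exec ω s with hs₁
  have a₁ := exec_agree ω (sweep 8 9 (adjTest 5 6)) s
  rw [← hs₁] at a₁
  have hh₁ : s₁.Holding I := hs.of_agree a₁ (by simp; omega) (by simp; omega)
  have ten : s₁.nat 10 = s.nat 10 := a₁.nat 10 (by simp)
  obtain ⟨T', hT', hrT, hfT⟩ := exec_sweep ω I (aS := 9) (aT := 8) (by norm_num)
    (by norm_num) (adjTest 6 5) hh₁ T S' (hT.of_arr_eq (a₁.arr 9 (by simp))) hS'
    (fun j i => I.adj i j) (fun j i s' h h1 h2 => h.adjTest_iff i j h2 h1)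
  rw [ten] at hrT hfT
  have a₂ := exec_agree ω (sweep 9 8 (adjTest 6 5)) s₁
  refine ⟨S', T', hS'.of_arr_eq (a₂.arr 8 (by simp)), hT',
    (DeleteStep.left hrS).trans (DeleteStep.right hrT), ?_⟩
  have cS := DeleteStep.eq_or_card_lt hrS
  have cT := DeleteStep.eq_or_card_lt hrT
  have lS := Finset.card_le_card (DeleteStep.subset hrS)
  have lT := Finset.card_le_card (DeleteStep.subset hrT)
  rcases cS with cS | cS
  · rcases cT with cT | cT
    · refine Or.inr ⟨cS, cT, not_cleanStep (hfS cS) ?_⟩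
      have := hfT cT
      rwa [cS] at this
    · left; omega
  · left; omega

/-- Delete vertices as long as possible. -/
def cleanProg : Prog := .loop 16 (.var 0) (.seq passProg passProg)

theorem cleanProg_nats_subset : cleanProg.nats ⊆ [16, 5, 6, 11, 12] := by
  simp [cleanProg, passProg, Prog.nats]

theorem cleanProg_arrs_subset : cleanProg.arrs ⊆ [8, 9] := by
  simp [cleanProg, passProg, Prog.arrs]

/-- Until the graph is stable every pass removes at least one of at most 2n vertices. The loop body
contains two passes, so that n iterations give the 2n passes needed. -/
theorem exec_cleanProg (ω : ℕ → ℝ) (I : Instance n d) {s : State} (hs : s.Holding I)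
    (S T : Finset (Fin n)) (hS : s.Rep 8 S) (hT : s.Rep 9 T) :
    ∃ S' T', (cleanProg.exec ω s).Rep 8 S' ∧ (cleanProg.exec ω s).Rep 9 T' ∧
      Relation.ReflTransGen (CleanStep I.adj (s.nat 10)) (S, T) (S', T') ∧
      ∀ q, ¬ CleanStep I.adj (s.nat 10) (S', T') q := by
  set r := s.nat 10 with hr
  let J : ℕ → State → Prop := fun m s' => ∃ S' T', s'.Rep 8 S' ∧ s'.Rep 9 T' ∧
      Relation.ReflTransGen (CleanStep I.adj r) (S, T) (S', T') ∧
      ((∀ q, ¬ CleanStep I.adj r (S', T') q) ∨ S'.card + T'.card + m ≤ 2 * n)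
  have hpn : passProg.nats ⊆ [5, 6, 11, 12] := by simp [passProg, Prog.nats]
  have hpa : passProg.arrs ⊆ [8, 9] := by simp [passProg, Prog.arrs]
  have step : ∀ (m : ℕ) (s' : State), s'.Holding I → s'.nat 10 = r → J m s' →
      J (m + 1) (passProg.exec ω s') := by
    rintro m s' hs' hr' ⟨S₁, T₁, h1, h2, h3, h4⟩
    obtain ⟨S₂, T₂, g1, g2, g3, g4⟩ := exec_passProg ω I hs' S₁ T₁ h1 h2
    rw [hr'] at g3 g4
    refine ⟨S₂, T₂, g1, g2, h3.trans g3, ?_⟩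
    rcases g4 with g4 | ⟨rfl, rfl, g4⟩
    · rcases h4 with h4 | h4
      -- A stable graph admits no cleaning step, so a pass cannot shrink it.
      · exfalso
        rcases g3.cases_head with he | ⟨q, hq, _⟩
        · simp only [Prod.mk.injEq] at he
          obtain ⟨rfl, rfl⟩ := he
          omega
        · exact h4 q hq
      · right; omega
    · exact Or.inl g4
  have := exec_loop_induction ω 16 (.var 0) (.seq passProg passProg) s (fun m => J (2 * m))
    (by
      have h1 : S.card ≤ n := by simpa using Finset.card_le_univ S
      have h2 : T.card ≤ n := by simpa using Finset.card_le_univ T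
      exact ⟨S, T, hS, hT, Relation.ReflTransGen.refl, Or.inr (by omega)⟩) (by
      intro i hi s' ha hJ
      have ha' : s.Agree [16, 5, 6, 11, 12] [8, 9] s' :=
        ha.mono cleanProg_nats_subset cleanProg_arrs_subset
      have hh₀ : s'.Holding I := hs.of_agree ha' (by simp; omega) (by simp; omega)
      set s₀ := (s'.setNat 16 i).tick 1 with hs₀
      have hh₀ : s₀.Holding I := hh₀.tick_setNat (by norm_num) _ _
      have hr₀ : s₀.nat 10 = r := by
        have := ha'.nat 10 (by simp)
        simp [hs₀, this, hr]
      have a₁ := (exec_agree ω passProg s₀).mono hpn hpa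
      have hh₁ := hh₀.of_agree a₁ (by simp; omega) (by simp; omega)
      have hr₁ : (passProg.exec ω s₀).nat 10 = r := (a₁.nat 10 (by simp)).trans hr₀
      exact step _ _ hh₁ hr₁ (step _ _ hh₀ hr₀ hJ))
  obtain ⟨S', T', h1, h2, h3, h4⟩ := this
  refine ⟨S', T', h1, h2, h3, ?_⟩
  rcases h4 with h4 | h4
  · exact h4
  -- If every pass made progress, no vertex is left and the empty graph is stable.
  · simp only [NExp.eval, hs.n_eq] at h4
    have e1 : S' = ∅ := Finset.card_eq_zero.1 (by omega)
    have e2 : T' = ∅ := Finset.card_eq_zero.1 (by omega)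
    subst e1 e2
    exact not_cleanStep (by simp) (by simp)

/-! ### Picking the biclique in the cleaned graph. -/

/-- Write in the array `15` the indicator of the set of vertices in the array `9` that are adjacent
to all vertices in the array `10`. -/
def commonProg : Prog :=
  markLoop 5 15 (.seq (.setN 11 (.const 0))
      (countLoop 6 11 (.and (memTest 10 6) (.not (adjTest 6 5)))))
    (.and (memTest 9 5) (.leN (.var 11) (.const 0)))

open Classical in
theorem exec_commonProg (ω : ℕ → ℝ) (I : Instance n d) {s : State} (hs : s.Holding I)
    (T A : Finset (Fin n)) (hT : s.Rep 9 T) (hA : s.Rep 10 A) :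
    (commonProg.exec ω s).Rep 15 (T.filter fun j => ∀ i ∈ A, I.adj i j) := by
  set c : Prog := .seq (.setN 11 (.const 0))
    (countLoop 6 11 (.and (memTest 10 6) (.not (adjTest 6 5)))) with hc
  have hcn : c.nats = [11, 6, 11] := rfl
  have hca : c.arrs = [] := rfl
  refine exec_markLoop ω c _ s hs.n_eq (by simp [hcn]) (by simp [hca]) _ ?_
  intro j s' ha hj
  rw [hcn, hca] at ha
  have hs' : s'.Holding I := hs.of_agree ha (by simp; omega) (by simp; omega)
  set s₁ := (Prog.setN 11 (.const 0)).exec ω s' with hs₁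
  have hh₁ : s₁.Holding I := hs'.tick_setNat (by norm_num) _ _
  have arr₁ : s₁.arr = s'.arr := rfl
  have five₁ : s₁.nat 5 = j := by simp [hs₁, hj]
  have hA₁ : s₁.Rep 10 A := hA.of_arr_eq (ha.arr 10 (by simp))
  have he : c.exec ω s' =
    (countLoop 6 11 (.and (memTest 10 6) (.not (adjTest 6 5)))).exec ω s₁ := rfl
  have hcount : (c.exec ω s').nat 11 =
      (Finset.univ.filter fun i => i ∈ A ∧ ¬ I.adj i j).card := by
    rw [he, exec_countLoop ω _ s₁ hh₁.n_eq (by norm_num) (fun i => i ∈ A ∧ ¬ I.adj i j)]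
    · have : s₁.nat 11 = 0 := by simp [hs₁, NExp.eval]
      rw [this, zero_add]
      congr!
    · intro i s'' h1 h2 h3
      have hh : s''.Holding I := hh₁.of_agree (xs := [6, 11]) (as := [])
        ⟨fun y hy => by simp at hy; exact h1 y hy.1 hy.2, fun a _ => by rw [h3]⟩
        (by simp; omega) (by simp)
      have m1 := (hA₁.of_arr_eq (s' := s'') (by rw [h3])).memTest_iff i h2
      have m2 := hh.adjTest_iff i j h2 (by rw [h1 5 (by norm_num) (by norm_num), five₁])
      simp only [BExp.Holds, m1, m2]
  have a₂ : s'.Agree [11, 6, 11] [] (c.exec ω s') := exec_agree ω c s'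
  have m1 := (hT.of_arr_eq (s' := c.exec ω s')
    ((a₂.arr 9 (by simp)).trans (ha.arr 9 (by simp)))).memTest_iff j
    ((a₂.nat 5 (by simp)).trans hj)
  simp only [BExp.Holds, m1, NExp.eval, hcount, Nat.le_zero, Finset.card_eq_zero,
    Finset.filter_eq_empty_iff, Finset.mem_filter]
  simp

/-- Copy the indicator in the array `src` to the array `dst`. -/
def copyProg (src dst : ℕ) : Prog := markLoop 5 dst .skip (memTest src 5)

theorem exec_copyProg (ω : ℕ → ℝ) {src dst : ℕ} (h : src ≠ dst) {s : State} (hn : s.nat 0 = n)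
    (S : Finset (Fin n)) (hS : s.Rep src S) : ((copyProg src dst).exec ω s).Rep dst S := by
  refine exec_markLoop ω _ _ s hn (by simp [Prog.nats]) (by simp [Prog.arrs]) S ?_
  intro i s' ha hi
  exact (hS.of_arr_eq (s' := Prog.skip.exec ω s')
    (ha.arr src (by simpa [Prog.arrs] using h))).memTest_iff i hi

/-- The extraction from the sets in the arrays `8`, `9` into the arrays `10`, `11`. -/
def extractProg : Prog :=
  .seq (pairCount 8 (adjTest 5 6)) (.seq (pairCount 9 (.not (adjTest 5 6))) (.seq paramProg
    (.seq cleanProg (.seq (pickLoop 8 10) (.seq commonProg (pickLoop 15 11))))))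

/-- Both picks find enough vertices: density survives cleaning and gives 2r vertices on each side,
and `le_card_common` provides r common neighbours. The case r = 0 is included. -/
theorem exec_extractProg (ω : ℕ → ℝ) (I : Instance n d) (hpos : 0 < n) {s : State}
    (hs : s.Holding I) (S T : Finset (Fin n)) (hS : s.Rep 8 S) (hT : s.Rep 9 T) :
    (extractProg.exec ω s).nat 10 = extractionParam I.adj S T ∧
    ∃ A B, (extractProg.exec ω s).Rep 10 A ∧ (extractProg.exec ω s).Rep 11 B ∧
      GreedyExtraction I.adj (extractionParam I.adj S T) S T A B := by
  classical
  set r := extractionParam I.adj S T with hr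
  set s₁ := (pairCount 8 (adjTest 5 6)).exec ω s with hs₁
  have a₁ : s.Agree [5, 6, 8] [] s₁ :=
    (exec_agree ω (pairCount 8 (adjTest 5 6)) s).mono (by simp [pairCount, Prog.nats])
      (by simp [pairCount, Prog.arrs])
  have hh₁ : s₁.Holding I := hs.of_agree a₁ (by simp; omega) (by simp)
  have f₁ : s₁.nat 8 = numEdges I.adj S T := exec_pairCount ω I (by norm_num) _ hs S T hS hT I.adj
    fun i j s' h h1 h2 => h.adjTest_iff i j h1 h2
  set s₂ := (pairCount 9 (.not (adjTest 5 6))).exec ω s₁ with hs₂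
  have a₂ : s₁.Agree [5, 6, 9] [] s₂ :=
    (exec_agree ω (pairCount 9 (.not (adjTest 5 6))) s₁).mono (by simp [pairCount, Prog.nats])
      (by simp [pairCount, Prog.arrs])
  have hh₂ : s₂.Holding I := hh₁.of_agree a₂ (by simp; omega) (by simp)
  have f₂ : s₂.nat 9 = numNonedges I.adj S T := by
    rw [numNonedges_eq]
    exact exec_pairCount ω I (by norm_num) _ hh₁ S T (hS.of_arr_eq (a₁.arr 8 (by simp)))
      (hT.of_arr_eq (a₁.arr 9 (by simp))) _
      fun i j s' h h1 h2 => not_congr (h.adjTest_iff i j h1 h2)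
  have f₁' : s₂.nat 8 = numEdges I.adj S T := (a₂.nat 8 (by simp)).trans f₁
  set s₃ := paramProg.exec ω s₂ with hs₃
  have a₃ : s₂.Agree [5, 10] [] s₃ :=
    (exec_agree ω paramProg s₂).mono (by simp [paramProg, Prog.nats])
      (by simp [paramProg, Prog.arrs])
  have hh₃ : s₃.Holding I := hh₂.of_agree a₃ (by simp; omega) (by simp)
  have r₃ : s₃.nat 10 = r := by
    have h1 := extractionParam_le I.adj S T
    have := exec_paramProg ω s₂ hh₂.n_eq hpos (by rw [f₁', f₂]; exact h1)
    rw [f₁', f₂] at this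
    exact this
  have arr₃ : s₃.arr = s.arr := by
    ext a : 1
    exact (a₃.arr a (by simp)).trans ((a₂.arr a (by simp)).trans (a₁.arr a (by simp)))
  obtain ⟨S', T', hS', hT', hrt, hfin⟩ := exec_cleanProg ω I hh₃ S T
    (hS.of_arr_eq (by rw [arr₃])) (hT.of_arr_eq (by rw [arr₃]))
  set s₄ := cleanProg.exec ω s₃ with hs₄
  rw [r₃] at hrt hfin
  have a₄ : s₃.Agree [16, 5, 6, 11, 12] [8, 9] s₄ :=
    (exec_agree ω cleanProg s₃).mono cleanProg_nats_subset cleanProg_arrs_subset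
  have hh₄ : s₄.Holding I := hh₃.of_agree a₄ (by simp; omega) (by simp; omega)
  have r₄ : s₄.nat 10 = r := (a₄.nat 10 (by simp)).trans r₃
  have hdens : 2 * n * r + 2 * r * numNonedges I.adj S' T' ≤ numEdges I.adj S' T' :=
    density_of_reflTransGen hrt (extractionParam_density I.adj S T)
  have hcard := le_card_of_density hpos hdens
  obtain ⟨A, hAS, hAr, hA⟩ := exec_pickLoop ω (src := 8) (dst := 10) s₄ hh₄.n_eq (by norm_num) S' hS'
    (by omega)
  rw [r₄] at hAr
  set s₅ := (pickLoop 8 10).exec ω s₄ with hs₅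
  have a₅ : s₄.Agree [13, 5] [10] s₅ :=
    (exec_agree ω (pickLoop 8 10) s₄).mono (by simp [pickLoop, Prog.nats])
      (by simp [pickLoop, Prog.arrs])
  have hh₅ : s₅.Holding I := hh₄.of_agree a₅ (by simp; omega) (by simp; omega)
  have r₅ : s₅.nat 10 = r := (a₅.nat 10 (by simp)).trans r₄
  have hcommon := exec_commonProg ω I hh₅ T' A (hT'.of_arr_eq (a₅.arr 9 (by simp))) hA
  set s₆ := commonProg.exec ω s₅ with hs₆
  have a₆ : s₅.Agree [5, 6, 11] [15] s₆ :=
    (exec_agree ω commonProg s₅).mono (by simp [commonProg, markLoop, Prog.nats])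
      (by simp [commonProg, markLoop, Prog.arrs])
  have hh₆ : s₆.Holding I := hh₅.of_agree a₆ (by simp; omega) (by simp; omega)
  have r₆ : s₆.nat 10 = r := (a₆.nat 10 (by simp)).trans r₅
  obtain ⟨B, hBT, hBr, hB⟩ := exec_pickLoop ω (src := 15) (dst := 11) s₆ hh₆.n_eq (by norm_num) _
    hcommon (by
      rw [r₆]
      exact le_card_common hcard.2 hfin hAS hAr)
  rw [r₆] at hBr
  set s₇ := (pickLoop 15 11).exec ω s₆ with hs₇
  have a₇ : s₆.Agree [13, 5] [11] s₇ :=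
    (exec_agree ω (pickLoop 15 11) s₆).mono (by simp [pickLoop, Prog.nats])
      (by simp [pickLoop, Prog.arrs])
  have hexec : extractProg.exec ω s = s₇ := rfl
  rw [hexec]
  refine ⟨(a₇.nat 10 (by simp)).trans r₆, A, B,
    hA.of_arr_eq ((a₇.arr 10 (by simp)).trans (a₆.arr 10 (by simp))), hB, S', T', hrt, hfin, hAS,
    hAr, fun j hj => (Finset.mem_filter.1 (hBT hj)).1, hBr,
    fun j hj => (Finset.mem_filter.1 (hBT hj)).2⟩

/-! ### Repeating rounds and keeping the best biclique. -/

/-- One round: the result is in the arrays `10`, `11` and its size in the variable `10`. -/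
def roundProg : Prog :=
  .seq drawProg (.seq (surviveProg 1 8) (.seq (surviveProg 2 9) extractProg))

/-- Keep the result of the round if it is larger than the best one so far. -/
def saveProg : Prog :=
  .ite (.leN (.add (.var 14) (.const 1)) (.var 10))
    (.seq (copyProg 10 5) (.seq (copyProg 11 6) (.setN 14 (.var 10)))) .skip

/-- The rounding algorithm. -/
def roundingProg : Prog :=
  .loop 2 (.var 0) (.loop 3 (.var 0) (.loop 4 (.var 0) (.seq roundProg saveProg)))

theorem roundingProg_tame : roundingProg.Tame := by
  simp [roundingProg, roundProg, saveProg, drawProg, surviveProg, markLoop, innerProg, sumLoop,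
    extractProg, pairCount, countLoop, paramProg, cleanProg, passProg, sweep, pickLoop, commonProg,
    copyProg, Prog.Tame]

/-- Memory layout. Integer variables: 2, 3, 4 are the outer loop counters, 5, 6, 7, 16 the inner
ones, 8 and 9 hold F and Q, 10 holds r, 11 to 13 are counters, 14 is the best size so far. Arrays:
5, 6 the best biclique, 7 the vector g, 8, 9 the current vertex sets, 10, 11 the result of the
round, 12 to 14 inner products, 15 the common neighbours. -/
theorem roundProg_nats : roundProg.nats ⊆ [5, 6, 7, 8, 9, 10, 11, 12, 13, 16] := by decide

theorem roundProg_arrs : roundProg.arrs ⊆ [7, 8, 9, 10, 11, 12, 13, 14, 15] := by decide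

theorem saveProg_nats : saveProg.nats ⊆ [5, 14] := by decide

theorem saveProg_arrs : saveProg.arrs ⊆ [5, 6] := by decide

theorem exec_roundProg (ω : ℕ → ℝ) (I : Instance n d) (hpos : 0 < n) {s : State}
    (hs : s.Holding I) {l : ℕ} (hl : s.drawn = l * d) :
    (roundProg.exec ω s).drawn = (l + 1) * d ∧
    (roundProg.exec ω s).nat 10 =
      extractionParam I.adj (I.survU (block d ω l)) (I.survV (block d ω l)) ∧
    ∃ A B, (roundProg.exec ω s).Rep 10 A ∧ (roundProg.exec ω s).Rep 11 B ∧
      I.RoundOutput (block d ω l) A B := by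
  set g := block d ω l with hg
  obtain ⟨hd₁, hd₁'⟩ := exec_drawProg ω s hs.d_eq
  set s₁ := drawProg.exec ω s with hs₁
  have a₁ : s.Agree [7] [7] s₁ := exec_agree ω drawProg s
  have hh₁ : s₁.Holding I := hs.of_agree a₁ (by simp; omega) (by simp; omega)
  have g₁ : ∀ a : Fin d, s₁.arr 7 0 a = g a := fun a => by rw [hd₁ a, hl]; rfl
  have hU := exec_surviveProg ω I g (src := 1) (dst := 8) (by norm_num) (by norm_num) hh₁ g₁ I.u
    hh₁.u_eq
  set s₂ := (surviveProg 1 8).exec ω s₁ with hs₂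
  have a₂ : s₁.Agree [5, 6] [8, 12, 13, 14] s₂ :=
    (exec_agree ω (surviveProg 1 8) s₁).mono (by decide) (by decide)
  have hh₂ : s₂.Holding I := hh₁.of_agree a₂ (by simp; omega) (by simp; omega)
  have hV := exec_surviveProg ω I g (src := 2) (dst := 9) (by norm_num) (by norm_num) hh₂
    (fun a => by rw [a₂.arr 7 (by simp)]; exact g₁ a) I.v hh₂.v_eq
  set s₃ := (surviveProg 2 9).exec ω s₂ with hs₃
  have a₃ : s₂.Agree [5, 6] [9, 12, 13, 14] s₃ :=
    (exec_agree ω (surviveProg 2 9) s₂).mono (by decide) (by decide)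
  have hh₃ : s₃.Holding I := hh₂.of_agree a₃ (by simp; omega) (by simp; omega)
  obtain ⟨hr, A, B, hA, hB, hgr⟩ := exec_extractProg ω I hpos hh₃ (I.survU g) (I.survV g)
    (hU.of_arr_eq (a₃.arr 8 (by simp))) hV
  have hexec : roundProg.exec ω s = extractProg.exec ω s₃ := rfl
  rw [hexec]
  refine ⟨?_, hr, A, B, hA, hB, ?_⟩
  · rw [exec_drawn (by decide), hs₃, exec_drawn (by decide), hs₂, exec_drawn (by decide), hd₁', hl]
    ring
  -- The program does not test for r = 0: extraction then picks two empty sets, which is the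
  -- prescribed empty biclique.
  · rcases Nat.eq_zero_or_pos (extractionParam I.adj (I.survU g) (I.survV g)) with h0 | h1
    · left
      obtain ⟨S', T', _, _, _, hA, _, hB, _⟩ := hgr
      rw [h0] at hA hB
      exact ⟨h0, Finset.card_eq_zero.1 hA, Finset.card_eq_zero.1 hB⟩
    · exact Or.inr ⟨h1, hgr⟩

/-- The state of the algorithm before round `l`. -/
def Instance.Progress (I : Instance n d) (ω : ℕ → ℝ) (l : ℕ) (s : State) : Prop :=
  s.Holding I ∧ s.drawn = l * d ∧ ∃ A B : Finset (Fin n), s.Rep 5 A ∧ s.Rep 6 B ∧ s.nat 14 = A.card ∧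
    (A = ∅ ∧ B = ∅ ∨ ∃ m < l, I.RoundOutput (block d ω m) A B) ∧
    ∀ m < l, extractionParam I.adj (I.survU (block d ω m)) (I.survV (block d ω m)) ≤ A.card

theorem Instance.Progress.of_agree {I : Instance n d} {ω : ℕ → ℝ} {l : ℕ} {s s' : State}
    (h : I.Progress ω l s) {x : ℕ} (hx : 2 ≤ x ∧ x < 5) (ha : s.Agree [x] [] s')
    (hd : s'.drawn = s.drawn) : I.Progress ω l s' := by
  obtain ⟨h1, h2, A, B, h3, h4, h5, h6⟩ := h
  exact ⟨h1.of_agree ha (by simp; omega) (by simp), hd.trans h2, A, B,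
    h3.of_arr_eq (ha.arr 5 (by simp)), h4.of_arr_eq (ha.arr 6 (by simp)),
    (ha.nat 14 (by simp; omega)).trans h5, h6⟩

theorem Instance.Progress.round {I : Instance n d} {ω : ℕ → ℝ} {l : ℕ} {s : State} (hpos : 0 < n)
    (h : I.Progress ω l s) : I.Progress ω (l + 1) ((Prog.seq roundProg saveProg).exec ω s) := by
  obtain ⟨hs, hd, A, B, hA, hB, hbest, hout, hmax⟩ := h
  obtain ⟨hd₁, hr₁, A₁, B₁, hA₁, hB₁, hout₁⟩ := exec_roundProg ω I hpos hs hd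
  have hcard := hout₁.card_eq.1
  rw [exec_seq]
  set s₁ := roundProg.exec ω s with hs₁
  have a₁ := (exec_agree ω roundProg s).mono roundProg_nats roundProg_arrs
  rw [← hs₁] at a₁
  have hh₁ : s₁.Holding I := hs.of_agree a₁ (by simp; omega) (by simp; omega)
  have b₁ : s₁.nat 14 = A.card := (a₁.nat 14 (by simp)).trans hbest
  have a₂ := (exec_agree ω saveProg s₁).mono saveProg_nats saveProg_arrs
  refine ⟨hh₁.of_agree a₂ (by simp; omega) (by simp; omega), ?_, ?_⟩
  · rw [exec_drawn (by decide), hd₁]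
  by_cases hlt : A.card + 1 ≤ A₁.card
  · have htest : (BExp.leN (.add (.var 14) (.const 1)) (.var 10)).Holds s₁ := by
      simp only [BExp.Holds, NExp.eval, b₁, hr₁]
      omega
    rw [saveProg, exec_ite_pos htest, exec_seq, exec_seq]
    set s₂ := s₁.tick ((BExp.leN (.add (.var 14) (.const 1)) (.var 10)).cost + 1) with hs₂
    set s₃ := (copyProg 10 5).exec ω s₂ with hs₃
    have a₃ : s₂.Agree [5] [5] s₃ := (exec_agree ω (copyProg 10 5) s₂).mono (by decide) (by decide)
    set s₄ := (copyProg 11 6).exec ω s₃ with hs₄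
    have a₄ : s₃.Agree [5] [6] s₄ := (exec_agree ω (copyProg 11 6) s₃).mono (by decide) (by decide)
    have h3 : s₃.Rep 5 A₁ := exec_copyProg ω (s := s₂) (by norm_num) hh₁.n_eq A₁ hA₁
    have h4 : s₄.Rep 6 B₁ := exec_copyProg ω (src := 11) (dst := 6) (by norm_num)
      ((a₃.nat 0 (by simp)).trans hh₁.n_eq) B₁ (hB₁.of_arr_eq (a₃.arr 11 (by simp)))
    have h10 : s₄.nat 10 = A₁.card := by
      rw [hcard, ← hr₁]
      exact (a₄.nat 10 (by simp)).trans (a₃.nat 10 (by simp))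
    refine ⟨A₁, B₁, h3.of_arr_eq (a₄.arr 5 (by simp)), h4, by simp [NExp.eval, h10],
      Or.inr ⟨l, by omega, hout₁⟩, fun m hm => ?_⟩
    rcases Nat.lt_succ_iff_lt_or_eq.1 hm with hm | rfl
    · have := hmax m hm
      omega
    · omega
  · have htest : ¬ (BExp.leN (.add (.var 14) (.const 1)) (.var 10)).Holds s₁ := by
      simp only [BExp.Holds, NExp.eval, b₁, hr₁]
      omega
    rw [saveProg, exec_ite_neg htest]
    refine ⟨A, B, hA.of_arr_eq (a₁.arr 5 (by simp)), hB.of_arr_eq (a₁.arr 6 (by simp)), b₁, ?_, ?_⟩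
    · rcases hout with h | ⟨m, hm, h⟩
      · exact Or.inl h
      · exact Or.inr ⟨m, by omega, h⟩
    · intro m hm
      rcases Nat.lt_succ_iff_lt_or_eq.1 hm with hm | rfl
      · exact hmax m hm
      · omega

/-- A body that advances k rounds becomes a loop that advances nk. Three nested applications,
starting from k = 1, give n³ rounds with all loop bounds equal to n. -/
theorem Instance.Progress.loop {I : Instance n d} {ω : ℕ → ℝ} {x k : ℕ} {c : Prog}
    (hx : 2 ≤ x ∧ x < 5)
    (hc : ∀ (l : ℕ) (s : State), I.Progress ω l s → I.Progress ω (l + k) (c.exec ω s)) (l : ℕ)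
    (s : State) (h : I.Progress ω l s) :
    I.Progress ω (l + n * k) ((Prog.loop x (.var 0) c).exec ω s) := by
  have := exec_loop_induction ω x (.var 0) c s (fun m s' => I.Progress ω (l + m * k) s')
    (by
      rw [zero_mul, add_zero]
      exact h.of_agree hx ⟨fun _ _ => rfl, fun _ _ => rfl⟩ rfl) (by
      intro i _ s' _ hJ
      have := hc _ ((s'.setNat x i).tick 1) (hJ.of_agree hx
        ⟨fun y hy => by simp at hy; simp [hy], fun _ _ => rfl⟩ rfl)
      rwa [add_assoc, ← Nat.succ_mul] at this)
  simpa [NExp.eval, h.1.n_eq] using this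

/-- The algorithm carries out the rounding procedure. -/
theorem roundingProg_correct (I : Instance n d) (hpos : 0 < n) (ω : ℕ → ℝ) :
    I.RoundingOutput ω (roundingProg.outU I ω) (roundingProg.outV I ω) ∧
    ∀ l < n ^ 3, extractionParam I.adj (I.survU (block d ω l)) (I.survV (block d ω l)) ≤
      (roundingProg.outU I ω).card := by
  have hinit : I.Progress ω 0 I.input :=
    ⟨I.input_holding, by simp [Instance.input], ∅, ∅, fun i => by simp [Instance.input],
      fun i => by simp [Instance.input], by simp [Instance.input], Or.inl ⟨rfl, rfl⟩, by simp⟩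
  have := Instance.Progress.loop (I := I) (ω := ω) (x := 2) (by norm_num)
    (Instance.Progress.loop (x := 3) (by norm_num)
      (Instance.Progress.loop (x := 4) (by norm_num)
        fun l s h => Instance.Progress.round hpos h)) 0 I.input hinit
  have hn3 : 0 + n * (n * (n * 1)) = n ^ 3 := by ring
  rw [hn3] at this
  obtain ⟨_, _, A, B, hA, hB, _, hout, hmax⟩ := this
  have eA : roundingProg.outU I ω = A := hA.readSet_eq
  have eB : roundingProg.outV I ω = B := hB.readSet_eq
  rw [eA, eB]
  refine ⟨⟨?_, fun l hl A' B' h => h.card_eq.1 ▸ hmax l hl⟩, hmax⟩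
  -- If nothing was ever saved, maximality makes the parameter of round 0 zero, so the empty
  -- biclique is a genuine output of that round.
  rcases hout with ⟨rfl, rfl⟩ | h
  · have h3 : 0 < n ^ 3 := Nat.pow_pos hpos
    exact ⟨0, h3, Or.inl ⟨by simpa using hmax 0 h3, rfl, rfl⟩⟩
  · exact h

/-! ### Gaussian estimates -/

theorem measurable_block (d l : ℕ) : Measurable fun ω : ℕ → ℝ => block d ω l := by
  unfold block
  fun_prop

/-- The positions l d + a are distinct for distinct pairs (l, a) with a < d, so the samples regroup
into an i.i.d. family indexed by pairs. Currying it gives i.i.d. rows, each a standard Gaussian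
vector. -/
theorem gaussianSamples_map_block (d : ℕ) :
    gaussianSamples.map (fun ω l => block d ω l) =
      Measure.infinitePi fun _ : ℕ => stdGaussian (EuclideanSpace ℝ (Fin d)) := by
  have hinj : Function.Injective fun p : ℕ × Fin d => p.1 * d + p.2 := by
    rintro ⟨l, a⟩ ⟨m, b⟩ h
    have hd : 0 < d := a.pos
    simp only at h
    have h1 : l = m := by
      have := congrArg (· / d) h
      simpa [Nat.mul_comm _ d, Nat.mul_add_div hd, Nat.div_eq_of_lt a.2, Nat.div_eq_of_lt b.2]
        using this
    subst h1
    have h2 : a = b := Fin.ext (by omega)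
    rw [h2]
  have h1 : gaussianSamples.map (fun ω (p : ℕ × Fin d) => ω (p.1 * d + p.2)) =
      Measure.infinitePi fun _ : ℕ × Fin d => gaussianReal 0 1 :=
    Measure.map_infinitePi_infinitePi_of_inj hinj
  have h2 := Measure.infinitePi_map_curry (fun (_ : ℕ) (_ : Fin d) => gaussianReal 0 1)
  have h3 := Measure.infinitePi_map_pi
    (fun _ : ℕ => Measure.infinitePi fun _ : Fin d => gaussianReal 0 1)
    (f := fun _ => (WithLp.toLp 2 : (Fin d → ℝ) → EuclideanSpace ℝ (Fin d)))
    (fun _ => by fun_prop)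
  simp only [Measure.infinitePi_eq_pi, map_pi_eq_stdGaussian] at h2 h3
  rw [← h3, ← h2, ← h1, Measure.map_map (by fun_prop) (by fun_prop),
    Measure.map_map (by fun_prop) (by fun_prop)]
  rfl

/-- The rounds are independent and identically distributed. -/
theorem gaussianSamples_forall_block (d N : ℕ) {s : Set (EuclideanSpace ℝ (Fin d))}
    (hs : MeasurableSet s) :
    gaussianSamples {ω | ∀ l < N, block d ω l ∈ s} =
      stdGaussian (EuclideanSpace ℝ (Fin d)) s ^ N := by
  have h := Measure.infinitePi_pi (fun _ : ℕ => stdGaussian (EuclideanSpace ℝ (Fin d)))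
    (s := Finset.range N) (t := fun _ => s) (fun _ _ => hs)
  rw [Finset.prod_const, Finset.card_range, ← gaussianSamples_map_block, Measure.map_apply
    (measurable_pi_lambda _ fun l => measurable_block d l)
    (MeasurableSet.pi (Finset.countable_toSet _) fun _ _ => hs)] at h
  rw [← h]
  congr 1
  ext ω
  simp

/-! ### Gaussian probabilities for one and two directions. -/

section

variable {E : Type*} [NormedAddCommGroup E] [InnerProductSpace ℝ E] [FiniteDimensional ℝ E]
  [MeasurableSpace E] [BorelSpace E]

theorem stdGaussian_map_inner (x : E) :
    (stdGaussian E).map (fun g => inner ℝ g x) = gaussianReal 0 (‖x‖ ^ 2).toNNReal := by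
  have h := IsGaussian.map_eq_gaussianReal (μ := stdGaussian E) (innerSL ℝ x)
  rw [integral_strongDual_stdGaussian, variance_dual_stdGaussian, innerSL_apply_norm] at h
  rw [← h]
  congr 1
  ext g
  simp [real_inner_comm]

/-- The two projections are jointly Gaussian with covariance ⟨x, y⟩ = 0. -/
theorem stdGaussian_indepFun_inner {x y : E} (h : inner ℝ x y = 0) :
    IndepFun (fun g => inner ℝ g x) (fun g => inner ℝ g y) (stdGaussian E) := by
  have hG : HasGaussianLaw (fun g : E => (inner ℝ g x, inner ℝ g y)) (stdGaussian E) := by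
    have := (IsGaussian.hasGaussianLaw_id (μ := stdGaussian E)).map_fun
      ((innerSL ℝ x).prod (innerSL ℝ y))
    simpa [real_inner_comm] using this
  refine hG.indepFun_of_covariance_eq_zero ?_
  have h2 := covarianceBilin_apply_eq_cov (μ := stdGaussian E) IsGaussian.memLp_two_id x y
  rw [covarianceBilin_stdGaussian] at h2
  have hc : ∀ z : E, (fun g : E => (inner ℝ g z : ℝ)) = fun g => inner ℝ z g := fun z =>
    funext fun g => real_inner_comm _ _
  rw [hc x, hc y, ← h2]
  exact h

/-- Chernoff's bound for ⟨g, a + b⟩ ≥ 2s, a centred Gaussian of variance at most 2 - 2δ. -/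
theorem stdGaussian_pair_le {a b : E} (ha : ‖a‖ = 1) (hb : ‖b‖ = 1) {s δ : ℝ} (hs : 0 ≤ s)
    (hδ : 0 ≤ δ) (h : inner ℝ a b ≤ -δ) :
    (stdGaussian E).real {g | s ≤ inner ℝ g a ∧ s ≤ inner ℝ g b} ≤
      Real.exp (-(s ^ 2 * (1 + δ))) := by
  have hsub : {g : E | s ≤ inner ℝ g a ∧ s ≤ inner ℝ g b} ⊆ {g | 2 * s ≤ inner ℝ g (a + b)} := by
    rintro g ⟨h1, h2⟩
    simp only [Set.mem_ofPred_eq, inner_add_right]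
    linarith
  refine (measureReal_mono hsub).trans ?_
  -- The optimal parameter for that variance would be s / (1 - δ). This choice avoids the division,
  -- and (1 - δ)(1 + δ) ≤ 1 still gives the exponent -2st + (1 - δ)t² ≤ -st.
  set t := s * (1 + δ) with ht
  have ht0 : 0 ≤ t := by positivity
  have hmap := stdGaussian_map_inner (a + b)
  have hint : Integrable (fun g : E => Real.exp (t * inner ℝ g (a + b))) (stdGaussian E) := by
    have := integrable_exp_mul_gaussianReal (μ := 0) (v := (‖a + b‖ ^ 2).toNNReal) t
    rw [← hmap] at this
    exact (integrable_map_measure (f := fun g : E => (inner ℝ g (a + b) : ℝ))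
      (g := fun z : ℝ => Real.exp (t * z)) (by fun_prop) (by fun_prop)).1 this
  have hch := measure_ge_le_exp_mul_mgf (μ := stdGaussian E) (X := fun g => inner ℝ g (a + b))
    (2 * s) ht0 hint
  refine hch.trans ?_
  rw [mgf_gaussianReal hmap, ← Real.exp_add]
  refine Real.exp_le_exp.2 ?_
  have hnorm : ‖a + b‖ ^ 2 ≤ 2 - 2 * δ := by
    rw [norm_add_sq_real, ha, hb]; linarith
  rw [Real.coe_toNNReal _ (sq_nonneg _)]
  have h1 : ‖a + b‖ ^ 2 * t ^ 2 ≤ (2 - 2 * δ) * t ^ 2 := by gcongr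
  have h2 : t ^ 2 * (1 - δ) ≤ t * s := by
    have : t ^ 2 * (1 - δ) = t * s * (1 - δ ^ 2) := by rw [ht]; ring
    rw [this]
    have : 0 ≤ t * s := by positivity
    nlinarith [sq_nonneg δ]
  have h3 : s ^ 2 * (1 + δ) = t * s := by rw [ht]; ring
  rw [h3]
  nlinarith

/-- On [-M, M] the Gaussian density is at least its value at M. -/
theorem gaussianReal_Icc_ge {a b M : ℝ} (hab : a ≤ b) (h1 : -M ≤ a) (h2 : b ≤ M) :
    (b - a) * ((√(2 * Real.pi))⁻¹ * Real.exp (-(M ^ 2 / 2))) ≤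
      (gaussianReal 0 1).real (Set.Icc a b) := by
  rw [measureReal_def, gaussianReal_apply_eq_integral _ one_ne_zero,
    ENNReal.toReal_ofReal (setIntegral_nonneg measurableSet_Icc
      fun x _ => gaussianPDFReal_nonneg _ _ _)]
  have := setIntegral_ge_of_const_le_real (μ := volume) (s := Set.Icc a b)
    (f := gaussianPDFReal 0 1) (c := (√(2 * Real.pi))⁻¹ * Real.exp (-(M ^ 2 / 2)))
    measurableSet_Icc (by simp) (by
      intro x hx
      simp only [gaussianPDFReal, NNReal.coe_one, mul_one, sub_zero]
      gcongr _ * Real.exp ?_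
      have : x ^ 2 ≤ M ^ 2 := sq_le_sq' (by linarith [hx.1]) (by linarith [hx.2])
      linarith) ((integrable_gaussianPDFReal 0 1).integrableOn)
  rw [Real.volume_real_Icc_of_le hab] at this
  linarith

/-- The projection is distributed as ‖x‖ z with z standard, and ‖x‖ ≥ 1/√2. -/
theorem stdGaussian_inner_ge {x : E} {s : ℝ} (hs : 0 ≤ s) (hx : 1 / 2 ≤ ‖x‖ ^ 2) :
    (gaussianReal 0 1).real {z | √2 * s ≤ z} ≤ (stdGaussian E).real {g | s ≤ inner ℝ g x} := by
  have h := stdGaussian_map_inner x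
  have e : (gaussianReal 0 1).map (fun z => ‖x‖ * z) = gaussianReal 0 (‖x‖ ^ 2).toNNReal := by
    rw [gaussianReal_map_const_mul]
    congr 1
    · simp
    · ext; simp
  have e1 : (stdGaussian E).real {g | s ≤ inner ℝ g x} =
      ((stdGaussian E).map (fun g => inner ℝ g x)).real (Set.Ici s) := by
    rw [map_measureReal_apply (by fun_prop) measurableSet_Ici]
    rfl
  rw [e1, h, ← e, map_measureReal_apply (by fun_prop) measurableSet_Ici]
  refine measureReal_mono ?_
  intro z hz
  simp only [Set.mem_ofPred_eq, Set.mem_preimage, Set.mem_Ici] at hz ⊢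
  have hz0 : 0 ≤ z := le_trans (by positivity) hz
  have h2 : 1 / √2 ≤ ‖x‖ := by
    rw [← Real.sqrt_sq (norm_nonneg x), ← Real.sqrt_one, ← Real.sqrt_div (by norm_num)]
    exact Real.sqrt_le_sqrt (by simpa using hx)
  have h3 : √2 * ‖x‖ ≥ 1 := by
    rw [div_le_iff₀ (by positivity)] at h2
    linarith
  have h4 : √2 * √2 = 2 := Real.mul_self_sqrt (by norm_num)
  calc s ≤ s * (√2 * ‖x‖) := le_mul_of_one_le_right hs h3
    _ = ‖x‖ * (√2 * s) := by ring
    _ ≤ ‖x‖ * z := by gcongr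

theorem stdGaussian_abs_inner_le {x : E} {ε : ℝ} (hx : ‖x‖ ≤ 1) :
    (gaussianReal 0 1).real (Set.Icc (-ε) ε) ≤ (stdGaussian E).real {g | |inner ℝ g x| ≤ ε} := by
  have h := stdGaussian_map_inner x
  have e : (gaussianReal 0 1).map (fun z => ‖x‖ * z) = gaussianReal 0 (‖x‖ ^ 2).toNNReal := by
    rw [gaussianReal_map_const_mul]
    congr 1
    · simp
    · ext; simp
  have e1 : (stdGaussian E).real {g | |inner ℝ g x| ≤ ε} =
      ((stdGaussian E).map (fun g => inner ℝ g x)).real (Set.Icc (-ε) ε) := by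
    rw [map_measureReal_apply (by fun_prop) measurableSet_Icc]
    congr 1
    ext g
    simp [abs_le]
  rw [e1, h, ← e, map_measureReal_apply (by fun_prop) measurableSet_Icc]
  refine measureReal_mono ?_
  intro z hz
  have hz' : |z| ≤ ε := abs_le.2 hz
  refine abs_le.1 ?_
  rw [abs_mul, abs_norm]
  calc ‖x‖ * |z| ≤ 1 * |z| := by gcongr
    _ ≤ ε := by linarith

/-- The half-sum x and half-difference y of the unit vectors are orthogonal, so their projections
are independent. It suffices that ⟨g, x⟩ is slightly above s and ⟨g, y⟩ is small, since a = x + y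
and b = x - y; nonnegative correlation gives ‖x‖² ≥ 1/2. -/
theorem stdGaussian_pair_ge {a b : E} (ha : ‖a‖ = 1) (hb : ‖b‖ = 1) {s : ℝ} (hs : 1 ≤ s)
    (h : 0 ≤ inner ℝ a b) :
    Real.exp (-9) / s ^ 2 * (2 * √2 / (2 * Real.pi)) * Real.exp (-s ^ 2) ≤
      (stdGaussian E).real {g | s ≤ inner ℝ g a ∧ s ≤ inner ℝ g b} := by
  set x : E := (1 / 2 : ℝ) • (a + b) with hx
  set y : E := (1 / 2 : ℝ) • (a - b) with hy
  have hs0 : 0 < s := by linarith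
  -- With slack 1/s, raising the threshold costs only a constant factor, because sε = 1; the windows
  -- for x and y each contribute one factor ε to the 1/s².
  set ε : ℝ := 1 / s with hε
  have hε0 : 0 < ε := by positivity
  have hε1 : ε ≤ 1 := by rw [hε, div_le_one hs0]; exact hs
  have hsε : s * ε = 1 := by rw [hε]; field_simp
  have hxn : 1 / 2 ≤ ‖x‖ ^ 2 := by
    rw [hx, norm_smul, mul_pow, norm_add_sq_real, ha, hb]
    norm_num
    linarith
  have hyn : ‖y‖ ≤ 1 := by
    rw [hy, norm_smul]
    have := norm_sub_le a b
    rw [ha, hb] at this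
    norm_num
    linarith
  have hxy : inner ℝ x y = 0 := by
    rw [hx, hy, inner_smul_left, inner_smul_right, inner_add_left, inner_sub_right, inner_sub_right,
      real_inner_self_eq_norm_sq, real_inner_self_eq_norm_sq, ha, hb, real_inner_comm]
    norm_num
  have hsub : {g : E | s + ε ≤ inner ℝ g x} ∩ {g | |inner ℝ g y| ≤ ε} ⊆
      {g | s ≤ inner ℝ g a ∧ s ≤ inner ℝ g b} := by
    rintro g ⟨h1, h2⟩
    have e1 : a = x + y := by rw [hx, hy]; module
    have e2 : b = x - y := by rw [hx, hy]; module
    simp only [Set.mem_ofPred_eq] at h1 h2 ⊢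
    rw [abs_le] at h2
    rw [e1, e2, inner_add_right, inner_sub_right]
    constructor <;> linarith [h2.1, h2.2]
  have hind : (stdGaussian E).real ({g : E | s + ε ≤ inner ℝ g x} ∩ {g | |inner ℝ g y| ≤ ε}) =
      (stdGaussian E).real {g : E | s + ε ≤ inner ℝ g x} *
        (stdGaussian E).real {g | |inner ℝ g y| ≤ ε} := by
    have := (stdGaussian_indepFun_inner hxy).measure_inter_preimage_eq_mul (Set.Ici (s + ε))
      {z | |z| ≤ ε} measurableSet_Ici (measurableSet_le (by fun_prop) measurable_const)
    rw [measureReal_def, measureReal_def, measureReal_def, ← ENNReal.toReal_mul]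
    exact congrArg ENNReal.toReal this
  have hX := stdGaussian_inner_ge (x := x) (s := s + ε) (by positivity) hxn
  have hY := stdGaussian_abs_inner_le (x := y) (ε := ε) hyn
  have h2 : 0 < √2 := by positivity
  have hX' : √2 * ε * ((√(2 * Real.pi))⁻¹ * Real.exp (-(s ^ 2 + 8))) ≤
      (gaussianReal 0 1).real {z | √2 * (s + ε) ≤ z} := by
    -- Only a window of length √2 ε of the tail is used. Half the square of its right end is s² +
    -- 4sε + 4ε² ≤ s² + 8.
    have := gaussianReal_Icc_ge (a := √2 * (s + ε)) (b := √2 * (s + 2 * ε)) (M := √2 * (s + 2 * ε))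
      (by gcongr; linarith)
      (by have : 0 ≤ √2 * (s + 2 * ε) := by positivity
          have : 0 ≤ √2 * (s + ε) := by positivity
          linarith) le_rfl
    refine le_trans ?_ (this.trans (measureReal_mono fun z hz => hz.1))
    have e : √2 * (s + 2 * ε) - √2 * (s + ε) = √2 * ε := by ring
    rw [e]
    gcongr
    have h4 : √2 ^ 2 = 2 := Real.sq_sqrt (by norm_num)
    rw [mul_pow, h4]
    nlinarith
  have hY' : 2 * ε * ((√(2 * Real.pi))⁻¹ * Real.exp (-1)) ≤
      (gaussianReal 0 1).real (Set.Icc (-ε) ε) := by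
    have := gaussianReal_Icc_ge (a := -ε) (b := ε) (M := ε) (by linarith) le_rfl le_rfl
    refine le_trans ?_ this
    have e : ε - -ε = 2 * ε := by ring
    rw [e]
    gcongr
    nlinarith
  calc Real.exp (-9) / s ^ 2 * (2 * √2 / (2 * Real.pi)) * Real.exp (-s ^ 2)
      = √2 * ε * ((√(2 * Real.pi))⁻¹ * Real.exp (-(s ^ 2 + 8))) *
          (2 * ε * ((√(2 * Real.pi))⁻¹ * Real.exp (-1))) := by
        have e1 : Real.exp (-(s ^ 2 + 8)) * Real.exp (-1) = Real.exp (-9) * Real.exp (-s ^ 2) := by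
          rw [← Real.exp_add, ← Real.exp_add]; congr 1; ring
        have e2 : (√(2 * Real.pi))⁻¹ * (√(2 * Real.pi))⁻¹ = (2 * Real.pi)⁻¹ := by
          rw [← mul_inv, Real.mul_self_sqrt (by positivity)]
        calc _ = 2 * √2 * ε ^ 2 * (2 * Real.pi)⁻¹ * (Real.exp (-9) * Real.exp (-s ^ 2)) := by
              rw [hε]; field_simp
          _ = _ := by rw [← e1, ← e2]; ring
    _ ≤ (stdGaussian E).real {g : E | s + ε ≤ inner ℝ g x} *
        (stdGaussian E).real {g | |inner ℝ g y| ≤ ε} := by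
        refine mul_le_mul (hX'.trans hX) (hY'.trans hY) (by positivity) measureReal_nonneg
    _ ≤ _ := by rw [← hind]; exact measureReal_mono hsub

end

/-! ### The geometry of a feasible solution -/

/-- The coefficient 1 - 1/√2 scales the e-component by 1/√2 and keeps the orthogonal part, so
exactly half of the product of the e-components is lost. -/
theorem Instance.Feasible.inner_shift {I : Instance n d} (hI : I.Feasible)
    (w z : EuclideanSpace ℝ (Fin d)) :
    inner ℝ (I.shift w) (I.shift z) = inner ℝ w z - inner ℝ w I.e * inner ℝ z I.e / 2 := by
  have he : inner ℝ I.e I.e = (1 : ℝ) := by rw [real_inner_self_eq_norm_sq, hI.norm_e]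
  have hs : (1 / √2) * (1 / √2) = (1 / 2 : ℝ) := by
    rw [div_mul_div_comm, Real.mul_self_sqrt (by norm_num)]; norm_num
  rw [Instance.shift, Instance.shift, inner_sub_left, inner_sub_right, inner_sub_right,
    inner_smul_left, inner_smul_right, inner_smul_left, inner_smul_right, he,
    real_inner_comm z I.e]
  simp only [conj_trivial]
  linear_combination inner ℝ w I.e * inner ℝ z I.e * hs

theorem Instance.Feasible.inner_e_mem {I : Instance n d} (hI : I.Feasible)
    {w : EuclideanSpace ℝ (Fin d)} (hw : ‖w‖ ^ 2 = inner ℝ w I.e) :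
    0 ≤ inner ℝ w I.e ∧ inner ℝ w I.e ≤ 1 := by
  refine ⟨hw ▸ sq_nonneg _, ?_⟩
  have he : ‖I.e‖ = 1 := by
    have := hI.norm_e
    exact (pow_eq_one_iff_of_nonneg (norm_nonneg _) two_ne_zero).1 this
  have h1 := real_inner_le_norm w I.e
  rw [he, mul_one] at h1
  nlinarith [norm_nonneg w]

theorem Instance.Feasible.norm_shift_sq {I : Instance n d} (hI : I.Feasible)
    {w : EuclideanSpace ℝ (Fin d)} (hw : ‖w‖ ^ 2 = inner ℝ w I.e) :
    ‖I.shift w‖ ^ 2 = inner ℝ w I.e - inner ℝ w I.e ^ 2 / 2 := by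
  rw [← real_inner_self_eq_norm_sq, hI.inner_shift, real_inner_self_eq_norm_sq, hw, sq]

theorem Instance.Feasible.k_le {I : Instance n d} (hI : I.Feasible) : I.k ≤ n := by
  rw [← hI.sum_u]
  refine (Finset.sum_le_sum fun i _ => (hI.inner_e_mem (hI.norm_u i)).2).trans ?_
  simp

theorem norm_normalize {x : EuclideanSpace ℝ (Fin d)} (h : 0 < ‖x‖) : ‖‖x‖⁻¹ • x‖ = 1 := by
  rw [norm_smul, norm_inv, norm_norm, inv_mul_cancel₀ h.ne']

/-- The vertex carrying `w` is heavy. -/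
def Instance.Heavy (I : Instance n d) (w : EuclideanSpace ℝ (Fin d)) : Prop :=
  1 / (8 * I.t) ≤ inner ℝ w I.e

theorem Instance.Feasible.norm_shift_pos {I : Instance n d} (hI : I.Feasible) (ht : 0 < I.t)
    {w : EuclideanSpace ℝ (Fin d)} (hw : ‖w‖ ^ 2 = inner ℝ w I.e) (hh : I.Heavy w) :
    0 < ‖I.shift w‖ := by
  have h1 := hI.norm_shift_sq hw
  have h2 := (hI.inner_e_mem hw).2
  have h3 : 0 < inner ℝ w I.e := lt_of_lt_of_le (by positivity) hh
  have h4 : 0 < ‖I.shift w‖ ^ 2 := by rw [h1]; nlinarith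
  exact lt_of_le_of_ne (norm_nonneg _) fun h => by rw [← h] at h4; norm_num at h4

/-- The normalized shifted vectors of heavy non-adjacent vertices are negatively correlated. -/
theorem Instance.Feasible.inner_normalized_le {I : Instance n d} (hI : I.Feasible) (ht : 0 < I.t)
    {w z : EuclideanSpace ℝ (Fin d)} (hw : ‖w‖ ^ 2 = inner ℝ w I.e)
    (hz : ‖z‖ ^ 2 = inner ℝ z I.e) (hhw : I.Heavy w) (hhz : I.Heavy z) (h : inner ℝ w z = 0) :
    inner ℝ (‖I.shift w‖⁻¹ • I.shift w) (‖I.shift z‖⁻¹ • I.shift z) ≤ -(1 / (16 * I.t)) := by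
  have pw := hI.norm_shift_pos ht hw hhw
  have pz := hI.norm_shift_pos ht hz hhz
  have nw := hI.norm_shift_sq hw
  have nz := hI.norm_shift_sq hz
  rw [inner_smul_left, inner_smul_right, hI.inner_shift, h, zero_sub]
  simp only [conj_trivial]
  unfold Instance.Heavy at hhw hhz
  set a := inner ℝ w I.e
  set b := inner ℝ z I.e
  set p := ‖I.shift w‖
  set q := ‖I.shift z‖
  set δ := 1 / (16 * I.t) with hδ
  have hδ0 : 0 < δ := by positivity
  have h8 : 1 / (8 * I.t) = 2 * δ := by rw [hδ]; field_simp; norm_num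
  rw [h8] at hhw hhz
  -- Squaring avoids √(ab): p² ≤ a and q² ≤ b by the norm formula, and ab ≥ (2δ)² by heaviness,
  -- where 2δ = 1/(8t).
  have hpq : (δ * (p * q)) ^ 2 ≤ (a * b / 2) ^ 2 := by
    have ha : p ^ 2 ≤ a := by rw [nw]; nlinarith [sq_nonneg a]
    have hb : q ^ 2 ≤ b := by rw [nz]; nlinarith [sq_nonneg b]
    have hab : p ^ 2 * q ^ 2 ≤ a * b := mul_le_mul ha hb (sq_nonneg _) (by linarith)
    have hδab : (2 * δ) * (2 * δ) ≤ a * b := mul_le_mul hhw hhz (by positivity) (by linarith)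
    calc (δ * (p * q)) ^ 2 = δ ^ 2 * (p ^ 2 * q ^ 2) := by ring
      _ ≤ (a * b / 4) * (a * b) := by
          refine mul_le_mul (by linarith) hab (by positivity) ?_
          have : 0 ≤ a * b := le_trans (by positivity) hδab
          linarith
      _ = _ := by ring
  have hle : δ * (p * q) ≤ a * b / 2 := by
    refine (pow_le_pow_iff_left₀ (by positivity) ?_ two_ne_zero).1 hpq
    have : 0 ≤ a * b := mul_nonneg (by linarith) (by linarith)
    linarith
  have e : p⁻¹ * (q⁻¹ * -(a * b / 2)) = -(a * b / 2 / (p * q)) := by field_simp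
  rw [e, neg_le_neg_iff, le_div_iff₀ (by positivity)]
  exact hle

open Classical in
/-- The pairs of heavy vertices whose shifted vectors are positively correlated. -/
def Instance.goodPairs (I : Instance n d) : Finset (Fin n × Fin n) :=
  Finset.univ.filter fun p => (I.Heavy (I.u p.1) ∧ I.Heavy (I.v p.2)) ∧
    0 < inner ℝ (I.shift (I.u p.1)) (I.shift (I.v p.2))

theorem Instance.mem_goodPairs (I : Instance n d) {p : Fin n × Fin n} :
    p ∈ I.goodPairs ↔ (I.Heavy (I.u p.1) ∧ I.Heavy (I.v p.2)) ∧
      0 < inner ℝ (I.shift (I.u p.1)) (I.shift (I.v p.2)) := by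
  simp [Instance.goodPairs]

/-- The heavy rows and columns of a matrix with row and column sums `k a` and `k b` carry most of
its weight. -/
theorem heavy_sum_ge {k : ℝ} (hk : 0 < k) (hn : 0 < n) (a b : Fin n → ℝ) (x : Fin n → Fin n → ℝ)
    (hx : ∀ i j, 0 ≤ x i j)
    (hsa : ∑ i, a i = k) (hxa : ∀ i, ∑ j, x i j = k * a i)
    (hxb : ∀ j, ∑ i, x i j = k * b j) (S T : Finset (Fin n)) (hS : ∀ i ∉ S, a i ≤ k / (8 * n))
    (hT : ∀ j ∉ T, b j ≤ k / (8 * n)) :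
    3 / 4 * k ^ 2 ≤ ∑ i ∈ S, ∑ j ∈ T, x i j := by
  have hn0 : (0 : ℝ) < n := by exact_mod_cast hn
  -- At most n light indices carry k/8 in total, so light rows and light columns each cost at most
  -- k²/8 of the weight k².
  have light : ∀ (c : Fin n → ℝ) (R : Finset (Fin n)), (∀ i ∉ R, c i ≤ k / (8 * n)) →
      ∑ i ∈ Rᶜ, c i ≤ k / 8 := by
    intro c R hc
    calc ∑ i ∈ Rᶜ, c i ≤ ∑ _i ∈ Rᶜ, k / (8 * n) :=
          Finset.sum_le_sum fun i hi => hc i (Finset.mem_compl.1 hi)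
      _ = Rᶜ.card * (k / (8 * n)) := by rw [Finset.sum_const, nsmul_eq_mul]
      _ ≤ n * (k / (8 * n)) := by
          gcongr
          simpa using Finset.card_le_univ Rᶜ
      _ = k / 8 := by field_simp
  have h1 : ∑ i ∈ S, a i = k - ∑ i ∈ Sᶜ, a i := by
    rw [← hsa, ← Finset.sum_add_sum_compl S]; ring
  have h2 : ∑ i ∈ S, ∑ j, x i j = k * ∑ i ∈ S, a i := by
    rw [Finset.mul_sum]
    exact Finset.sum_congr rfl fun i _ => hxa i
  have h3 : ∑ i ∈ S, ∑ j, x i j = ∑ i ∈ S, ∑ j ∈ T, x i j + ∑ i ∈ S, ∑ j ∈ Tᶜ, x i j := by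
    rw [← Finset.sum_add_distrib]
    exact Finset.sum_congr rfl fun i _ => (Finset.sum_add_sum_compl T _).symm
  have h4 : ∑ i ∈ S, ∑ j ∈ Tᶜ, x i j ≤ k * ∑ j ∈ Tᶜ, b j := by
    rw [Finset.sum_comm, Finset.mul_sum]
    refine Finset.sum_le_sum fun j _ => ?_
    rw [← hxb j]
    exact Finset.sum_le_sum_of_subset_of_nonneg (Finset.subset_univ _) fun i _ _ => hx i j
  have h5 := light a S hS
  have h6 := light b T hT
  nlinarith

/-- Over heavy pairs the shifted inner products sum to at least 3k²/4 - k²/2. Shifted vectors have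
norm at most 1, so each term is at most 1 and the positive ones number at least k²/4. -/
theorem Instance.Feasible.card_goodPairs {I : Instance n d} (hI : I.Feasible) (hn : 0 < n)
    (hk : 0 < I.k) : I.k ^ 2 / 4 ≤ I.goodPairs.card := by
  classical
  have hn0 : (0 : ℝ) < n := by exact_mod_cast hn
  set S : Finset (Fin n) := Finset.univ.filter fun i => I.Heavy (I.u i) with hS
  set T : Finset (Fin n) := Finset.univ.filter fun j => I.Heavy (I.v j) with hT
  have ht : 1 / (8 * I.t) = I.k / (8 * n) := by rw [Instance.t]; field_simp
  have h1 := heavy_sum_ge hk hn (fun i => inner ℝ (I.u i) I.e) (fun j => inner ℝ (I.v j) I.e)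
    (fun i j => inner ℝ (I.u i) (I.v j)) hI.nonneg hI.sum_u hI.fracDeg_u hI.fracDeg_v S T
    (fun i hi => by
      simp only [hS, Finset.mem_filter, Finset.mem_univ, true_and, Instance.Heavy, not_le, ht] at hi
      exact hi.le)
    (fun j hj => by
      simp only [hT, Finset.mem_filter, Finset.mem_univ, true_and, Instance.Heavy, not_le, ht] at hj
      exact hj.le)
  have h2 : ∑ i ∈ S, ∑ j ∈ T, inner ℝ (I.u i) I.e * inner ℝ (I.v j) I.e ≤ I.k ^ 2 := by
    rw [← Finset.sum_mul_sum, sq]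
    have nu : ∀ i, 0 ≤ inner ℝ (I.u i) I.e := fun i => (hI.inner_e_mem (hI.norm_u i)).1
    have nv : ∀ j, 0 ≤ inner ℝ (I.v j) I.e := fun j => (hI.inner_e_mem (hI.norm_v j)).1
    refine mul_le_mul ?_ ?_ (Finset.sum_nonneg fun j _ => nv j) hk.le
    · rw [← hI.sum_u]
      exact Finset.sum_le_sum_of_subset_of_nonneg (Finset.subset_univ _) fun i _ _ => nu i
    · rw [← hI.sum_v]
      exact Finset.sum_le_sum_of_subset_of_nonneg (Finset.subset_univ _) fun i _ _ => nv i
  have h3 : ∑ p ∈ S ×ˢ T, inner ℝ (I.shift (I.u p.1)) (I.shift (I.v p.2)) =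
      ∑ i ∈ S, ∑ j ∈ T, inner ℝ (I.u i) (I.v j) -
        (∑ i ∈ S, ∑ j ∈ T, inner ℝ (I.u i) I.e * inner ℝ (I.v j) I.e) / 2 := by
    rw [Finset.sum_product, Finset.sum_div, ← Finset.sum_sub_distrib]
    refine Finset.sum_congr rfl fun i _ => ?_
    rw [Finset.sum_div, ← Finset.sum_sub_distrib]
    exact Finset.sum_congr rfl fun j _ => hI.inner_shift _ _
  have norm_le : ∀ w : EuclideanSpace ℝ (Fin d), ‖w‖ ^ 2 = inner ℝ w I.e → ‖I.shift w‖ ≤ 1 := by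
    intro w hw
    have h4 := hI.norm_shift_sq hw
    have h5 := hI.inner_e_mem hw
    refine (sq_le_one_iff₀ (norm_nonneg _)).1 ?_
    rw [h4]
    nlinarith [sq_nonneg (inner ℝ w I.e)]
  have h6 : ∑ p ∈ S ×ˢ T, inner ℝ (I.shift (I.u p.1)) (I.shift (I.v p.2)) ≤
      ∑ p ∈ S ×ˢ T, if 0 < inner ℝ (I.shift (I.u p.1)) (I.shift (I.v p.2)) then (1 : ℝ) else 0 := by
    refine Finset.sum_le_sum fun p _ => ?_
    split_ifs with h
    · refine (real_inner_le_norm _ _).trans ?_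
      exact mul_le_one₀ (norm_le _ (hI.norm_u _)) (norm_nonneg _) (norm_le _ (hI.norm_v _))
    · exact not_lt.1 h
  have h7 : I.goodPairs = (S ×ˢ T).filter fun p =>
      0 < inner ℝ (I.shift (I.u p.1)) (I.shift (I.v p.2)) := by
    ext p
    simp [Instance.goodPairs, hS, hT]
  rw [h7, ← Finset.sum_boole]
  linarith

/-- On a non-edge the shifted inner product is -c_i c_j / 2 ≤ 0. -/
theorem Instance.Feasible.adj_of_mem_goodPairs {I : Instance n d} (hI : I.Feasible)
    {p : Fin n × Fin n} (hp : p ∈ I.goodPairs) : I.adj p.1 p.2 := by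
  by_contra h
  have h1 := (I.mem_goodPairs.1 hp).2
  rw [hI.inner_shift, hI.nonedge _ _ h] at h1
  have := mul_nonneg (hI.inner_e_mem (hI.norm_u p.1)).1 (hI.inner_e_mem (hI.norm_v p.2)).1
  linarith

/-! ### One round succeeds with probability at least `1 / n` -/

/-- The samples for which both vertices of a pair survive. -/
def Instance.survivePair (I : Instance n d) (p : Fin n × Fin n) :
    Set (EuclideanSpace ℝ (Fin d)) :=
  {g | I.Survives g (I.u p.1) ∧ I.Survives g (I.v p.2)}

theorem Instance.measurableSet_survives (I : Instance n d) (w : EuclideanSpace ℝ (Fin d)) :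
    MeasurableSet {g | I.Survives g w} :=
  (MeasurableSet.const (1 / (8 * I.t) ≤ inner ℝ w I.e)).inter
    (measurableSet_le (f := fun _ => √((1 / 10) * Real.log n))
      (g := fun g => inner ℝ g (‖I.shift w‖⁻¹ • I.shift w)) measurable_const (by fun_prop))

theorem Instance.measurableSet_survivePair (I : Instance n d) (p : Fin n × Fin n) :
    MeasurableSet (I.survivePair p) :=
  (I.measurableSet_survives _).inter (I.measurableSet_survives _)

theorem Instance.Feasible.survivePair_le {I : Instance n d} (hI : I.Feasible) (ht : 0 < I.t)
    {p : Fin n × Fin n} (hp : ¬ I.adj p.1 p.2) :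
    (stdGaussian (EuclideanSpace ℝ (Fin d))).real (I.survivePair p) ≤
      Real.exp (-(1 / 10 * Real.log n * (1 + 1 / (16 * I.t)))) := by
  by_cases h : I.Heavy (I.u p.1) ∧ I.Heavy (I.v p.2)
  · have hlog : 0 ≤ 1 / 10 * Real.log n := mul_nonneg (by norm_num) (Real.log_natCast_nonneg n)
    have h1 := stdGaussian_pair_le
      (norm_normalize (hI.norm_shift_pos ht (hI.norm_u p.1) h.1))
      (norm_normalize (hI.norm_shift_pos ht (hI.norm_v p.2) h.2))
      (Real.sqrt_nonneg (1 / 10 * Real.log n)) (by positivity)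
      (hI.inner_normalized_le ht (hI.norm_u p.1) (hI.norm_v p.2) h.1 h.2 (hI.nonedge _ _ hp))
    rw [Real.sq_sqrt hlog] at h1
    refine le_trans (measureReal_mono fun g hg => ?_) h1
    exact ⟨hg.1.2, hg.2.2⟩
  · have : I.survivePair p = ∅ := by
      ext g
      simp only [Set.mem_empty_iff_false, iff_false]
      exact fun hg => h ⟨hg.1.1, hg.2.1⟩
    rw [this, measureReal_empty]
    positivity

theorem Instance.Feasible.le_survivePair {I : Instance n d} (hI : I.Feasible) (ht : 0 < I.t)
    (hlog : 10 ≤ Real.log n) {p : Fin n × Fin n} (hp : p ∈ I.goodPairs) :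
    Real.exp (-9) / Real.log n * Real.exp (-(1 / 10 * Real.log n)) ≤
      (stdGaussian (EuclideanSpace ℝ (Fin d))).real (I.survivePair p) := by
  obtain ⟨h, hpos⟩ := I.mem_goodPairs.1 hp
  have pu := hI.norm_shift_pos ht (hI.norm_u p.1) h.1
  have pv := hI.norm_shift_pos ht (hI.norm_v p.2) h.2
  have h1 := stdGaussian_pair_ge (norm_normalize pu)
    (norm_normalize pv) (s := √(1 / 10 * Real.log n))
    (by rw [← Real.sqrt_one]; exact Real.sqrt_le_sqrt (by linarith))
    (by
      rw [inner_smul_left, inner_smul_right]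
      simp only [conj_trivial]
      positivity)
  rw [Real.sq_sqrt (by linarith)] at h1
  refine le_trans ?_ (h1.trans (measureReal_mono
    (show _ ⊆ I.survivePair p from fun g hg => ⟨⟨h.1, hg.1⟩, ⟨h.2, hg.2⟩⟩)))
  gcongr
  -- Together with 1/s² = 10 / log n this leaves a spare factor 10/4.
  have h2 : 1 / 4 ≤ 2 * √2 / (2 * Real.pi) := by
    rw [div_le_div_iff₀ (by norm_num) (by positivity)]
    have : 1 ≤ √2 := Real.one_le_sqrt.2 (by norm_num)
    linarith [Real.pi_le_four]
  have h3 : (0 : ℝ) < Real.log n := by linarith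
  calc Real.exp (-9) / Real.log n
      ≤ Real.exp (-9) / (1 / 10 * Real.log n) * (1 / 4) := by
        have : Real.exp (-9) / (1 / 10 * Real.log n) * (1 / 4) =
            10 / 4 * (Real.exp (-9) / Real.log n) := by field_simp
        rw [this]
        have : 0 < Real.exp (-9) / Real.log n := by positivity
        linarith
    _ ≤ _ := by gcongr

/-- The samples for which the density of the surviving graph allows extraction with parameter `r`. -/
def Instance.denseSamples (I : Instance n d) (r : ℕ) : Set (EuclideanSpace ℝ (Fin d)) :=
  {g | 2 * n * r + 2 * r * numNonedges I.adj (I.survU g) (I.survV g) ≤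
    numEdges I.adj (I.survU g) (I.survV g)}

theorem Instance.le_extractionParam (I : Instance n d) (hn : 0 < n) {r : ℕ}
    {g : EuclideanSpace ℝ (Fin d)} (hg : g ∈ I.denseSamples r) :
    r ≤ extractionParam I.adj (I.survU g) (I.survV g) := by
  rw [extractionParam, Nat.le_div_iff_mul_le (by omega)]
  have : 2 * n * r + 2 * r * numNonedges I.adj (I.survU g) (I.survV g) ≤
    numEdges I.adj (I.survU g) (I.survV g) := hg
  linarith

-- Writing the count as a sum of indicators makes it measurable and allows linearity of expectation.
open Classical in
theorem Instance.numEdges_surv (I : Instance n d) (R : Fin n → Fin n → Prop)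
    (g : EuclideanSpace ℝ (Fin d)) :
    (numEdges R (I.survU g) (I.survV g) : ℝ) =
      ∑ p ∈ Finset.univ.filter (fun p : Fin n × Fin n => R p.1 p.2),
        (I.survivePair p).indicator (fun _ => (1 : ℝ)) g := by
  have h : (I.survU g ×ˢ I.survV g).filter (fun p => R p.1 p.2) =
      (Finset.univ.filter (fun p : Fin n × Fin n => R p.1 p.2)).filter
        fun p => g ∈ I.survivePair p := by
    ext p
    simp only [Finset.mem_filter, Finset.mem_product, Instance.survU, Instance.survV,
      Finset.mem_univ, true_and]
    exact and_comm
  rw [numEdges, h, ← Finset.sum_boole]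
  simp [Set.indicator_apply]

theorem Instance.measurable_numEdges_surv (I : Instance n d) (R : Fin n → Fin n → Prop) :
    Measurable fun g => (numEdges R (I.survU g) (I.survV g) : ℝ) := by
  simp_rw [I.numEdges_surv R]
  exact Finset.measurable_sum _ fun p _ =>
    measurable_const.indicator (I.measurableSet_survivePair p)

theorem Instance.measurableSet_denseSamples (I : Instance n d) (r : ℕ) :
    MeasurableSet (I.denseSamples r) := by
  have h1 := I.measurable_numEdges_surv I.adj
  have h2 := I.measurable_numEdges_surv (fun i j => ¬ I.adj i j)
  have : I.denseSamples r = {g | 2 * (n : ℝ) * r +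
      2 * r * (numEdges (fun i j => ¬ I.adj i j) (I.survU g) (I.survV g) : ℝ) ≤
        (numEdges I.adj (I.survU g) (I.survV g) : ℝ)} := by
    ext g
    simp only [Instance.denseSamples, Set.mem_ofPred_eq, numNonedges_eq]
    exact_mod_cast Iff.rfl
  rw [this]
  exact measurableSet_le (by fun_prop) h1

open Classical in
theorem Instance.integral_numEdges_surv (I : Instance n d) (R : Fin n → Fin n → Prop) :
    Integrable (fun g => (numEdges R (I.survU g) (I.survV g) : ℝ))
      (stdGaussian (EuclideanSpace ℝ (Fin d))) ∧
    ∫ g, (numEdges R (I.survU g) (I.survV g) : ℝ) ∂stdGaussian (EuclideanSpace ℝ (Fin d)) =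
      ∑ p ∈ Finset.univ.filter (fun p : Fin n × Fin n => R p.1 p.2),
        (stdGaussian (EuclideanSpace ℝ (Fin d))).real (I.survivePair p) := by
  have hint : ∀ p, Integrable ((I.survivePair p).indicator fun _ => (1 : ℝ))
      (stdGaussian (EuclideanSpace ℝ (Fin d))) := fun p =>
    (integrable_const _).indicator (I.measurableSet_survivePair p)
  simp_rw [I.numEdges_surv R]
  refine ⟨integrable_finsetSum _ fun p _ => hint p, ?_⟩
  rw [integral_finsetSum _ fun p _ => hint p]
  refine Finset.sum_congr rfl fun p _ => ?_
  rw [integral_indicator_const _ (I.measurableSet_survivePair p)]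
  simp

/-- A lower bound for the probability that the surviving graph is dense, by its first moment. -/
theorem Instance.Feasible.denseSamples_ge {I : Instance n d} (hI : I.Feasible) {a b : ℝ}
    (ha0 : 0 ≤ b)
    (ha : ∀ p ∈ I.goodPairs, a ≤ (stdGaussian (EuclideanSpace ℝ (Fin d))).real (I.survivePair p))
    (hb : ∀ p : Fin n × Fin n, ¬ I.adj p.1 p.2 →
      (stdGaussian (EuclideanSpace ℝ (Fin d))).real (I.survivePair p) ≤ b) (r : ℕ) :
    I.goodPairs.card * a - 2 * r * (n ^ 2 * b) - 2 * n * r ≤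
      n ^ 2 * (stdGaussian (EuclideanSpace ℝ (Fin d))).real (I.denseSamples r) := by
  classical
  set γ := stdGaussian (EuclideanSpace ℝ (Fin d)) with hγ
  obtain ⟨iF, eF⟩ := I.integral_numEdges_surv I.adj
  obtain ⟨iQ, eQ⟩ := I.integral_numEdges_surv (fun i j => ¬ I.adj i j)
  have hF : I.goodPairs.card * a ≤ ∫ g, (numEdges I.adj (I.survU g) (I.survV g) : ℝ) ∂γ := by
    rw [eF]
    calc I.goodPairs.card * a = ∑ _p ∈ I.goodPairs, a := by rw [Finset.sum_const, nsmul_eq_mul]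
      _ ≤ ∑ p ∈ I.goodPairs, γ.real (I.survivePair p) := Finset.sum_le_sum ha
      _ ≤ _ := Finset.sum_le_sum_of_subset_of_nonneg
          (fun p hp => Finset.mem_filter.2 ⟨Finset.mem_univ _, hI.adj_of_mem_goodPairs hp⟩)
          fun _ _ _ => measureReal_nonneg
  have hQ : ∫ g, (numEdges (fun i j => ¬ I.adj i j) (I.survU g) (I.survV g) : ℝ) ∂γ ≤
      n ^ 2 * b := by
    rw [eQ]
    refine (Finset.sum_le_sum fun p hp => hb p (by simpa using hp)).trans ?_
    rw [Finset.sum_const, nsmul_eq_mul]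
    gcongr
    have h := Finset.card_le_univ (Finset.univ.filter fun p : Fin n × Fin n => ¬ I.adj p.1 p.2)
    rw [Fintype.card_prod, Fintype.card_fin, ← sq] at h
    refine le_trans (le_of_eq ?_) (Nat.cast_le (α := ℝ).2 h |>.trans_eq (Nat.cast_pow n 2))
    congr!
  -- F - 2rQ - 2nr is at most n² on dense samples and negative elsewhere, so its expectation is at
  -- most n² times the probability of density.
  have hpt : ∀ g, (numEdges I.adj (I.survU g) (I.survV g) : ℝ) -
      2 * r * (numEdges (fun i j => ¬ I.adj i j) (I.survU g) (I.survV g) : ℝ) - 2 * n * r ≤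
      (I.denseSamples r).indicator (fun _ => (n : ℝ) ^ 2) g := by
    intro g
    by_cases hg : g ∈ I.denseSamples r
    · rw [Set.indicator_of_mem hg]
      have h1 := numEdges_le I.adj (I.survU g) (I.survV g)
      have hS : (I.survU g).card ≤ n := by simpa using Finset.card_le_univ (I.survU g)
      have hT : (I.survV g).card ≤ n := by simpa using Finset.card_le_univ (I.survV g)
      have h2 : (numEdges I.adj (I.survU g) (I.survV g) : ℝ) ≤ (n : ℝ) ^ 2 := by
        rw [sq]
        exact_mod_cast h1.trans (Nat.mul_le_mul hS hT)
      have h3 : (0 : ℝ) ≤ 2 * r * (numEdges (fun i j => ¬ I.adj i j) (I.survU g) (I.survV g)) := by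
        positivity
      have h4 : (0 : ℝ) ≤ 2 * n * r := by positivity
      linarith
    · rw [Set.indicator_of_notMem hg]
      have : ((numEdges I.adj (I.survU g) (I.survV g) : ℕ) : ℝ) < ((2 * n * r +
          2 * r * numEdges (fun i j => ¬ I.adj i j) (I.survU g) (I.survV g) : ℕ) : ℝ) := by
        simp only [Instance.denseSamples, Set.mem_ofPred_eq, numNonedges_eq, not_le] at hg
        exact_mod_cast hg
      push_cast at this
      linarith
  have iL : Integrable (fun g => (numEdges I.adj (I.survU g) (I.survV g) : ℝ) -
      2 * r * (numEdges (fun i j => ¬ I.adj i j) (I.survU g) (I.survV g) : ℝ)) γ :=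
    iF.sub (iQ.const_mul _)
  have hmono := integral_mono (μ := γ) (iL.sub (integrable_const (2 * (n : ℝ) * r)))
    ((integrable_const ((n : ℝ) ^ 2)).indicator (I.measurableSet_denseSamples r)) hpt
  rw [integral_indicator_const _ (I.measurableSet_denseSamples r)] at hmono
  have e : ∫ g, ((numEdges I.adj (I.survU g) (I.survV g) : ℝ) -
      2 * r * (numEdges (fun i j => ¬ I.adj i j) (I.survU g) (I.survV g) : ℝ) - 2 * n * r) ∂γ =
      ∫ g, (numEdges I.adj (I.survU g) (I.survV g) : ℝ) ∂γ -
      2 * r * ∫ g, (numEdges (fun i j => ¬ I.adj i j) (I.survU g) (I.survV g) : ℝ) ∂γ -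
      2 * n * r := by
    rw [integral_sub iL (integrable_const _), integral_sub iF (iQ.const_mul _),
      integral_const_mul, integral_const, probReal_univ, one_smul]
  have hmono' : ∫ g, ((numEdges I.adj (I.survU g) (I.survV g) : ℝ) -
      2 * r * (numEdges (fun i j => ¬ I.adj i j) (I.survU g) (I.survV g) : ℝ) - 2 * n * r) ∂γ ≤
      γ.real (I.denseSamples r) • (n : ℝ) ^ 2 := hmono
  rw [e, smul_eq_mul, mul_comm (γ.real _)] at hmono'
  have : 2 * (r : ℝ) * ∫ g, (numEdges (fun i j => ¬ I.adj i j) (I.survU g) (I.survV g) : ℝ) ∂γ ≤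
      2 * r * (n ^ 2 * b) := by gcongr
  linarith

/-! ### The success probability of the algorithm -/

/-- The constant of the theorem. -/
def approxConst : ℝ := 1000000

/-- A uniform positive bound turns the hypothesis on k into log n ≥ 80000, so small n need no
separate treatment. It comes from 3 ≥ 1.1 e and log x ≥ 1 - 1/x, used at 1.1 and at 1.09. -/
theorem log_log_ge {x : ℝ} (hx : 3 ≤ x) : 2 / 25 ≤ Real.log (Real.log x) := by
  have h1 : 109 / 100 ≤ Real.log x := by
    have h2 : Real.exp 1 * (11 / 10) ≤ x := by
      have := Real.exp_one_lt_d9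
      linarith
    have h3 := Real.log_le_log (by positivity) h2
    rw [Real.log_mul (Real.exp_ne_zero _) (by norm_num), Real.log_exp] at h3
    have h4 := Real.one_sub_inv_le_log_of_pos (x := 11 / 10) (by norm_num)
    norm_num at h4
    linarith
  have h5 := Real.log_le_log (by norm_num) h1
  have h6 := Real.one_sub_inv_le_log_of_pos (x := 109 / 100) (by norm_num)
  norm_num at h6
  linarith

/-- The first moment estimate, with `L = log n` and `y = L / (D t)`. -/
theorem first_moment_ge {L y N c r : ℝ} (hN : N = Real.exp L) (hL : 80000 ≤ L)
    (hy : Real.log L ≤ y) (hyL : 1000000 * y ≤ L)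
    (hc : N ^ 2 / (4 * Real.exp y ^ 2) ≤ c) (hr : r ≤ 2 * Real.exp y) {b : ℝ} (hb0 : 0 ≤ b)
    (hb : b ≤ Real.exp (-(1 / 10 * L)) * Real.exp (-(6 * y))) :
    N ≤ c * (Real.exp (-9) / L * Real.exp (-(1 / 10 * L))) - 2 * r * (N ^ 2 * b) - 2 * N * r := by
  set M := Real.exp y with hM
  have hML : L ≤ M := by
    rw [hM, ← Real.exp_log (show 0 < L by linarith)]
    exact Real.exp_le_exp.2 hy
  have hM0 : 0 < M := Real.exp_pos y
  have hL0 : 0 < L := by linarith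
  have hN0 : 0 < N := by rw [hN]; positivity
  set q := Real.exp (-(1 / 10 * L)) with hq
  have hq0 : 0 < q := Real.exp_pos _
  -- All terms are measured in units of W. The good pairs contribute at least (κ/4) W, since c ≥
  -- N²/(4M²) and L ≤ M; each of the two losses is at most (κ/8) W.
  set W := N ^ 2 * q / M ^ 3 with hW
  have hW0 : 0 < W := by positivity
  set κ := Real.exp (-9) with hκ
  have hκ0 : 0 < κ := Real.exp_pos _
  have hκM : 1 ≤ κ * (M ^ 2 / 100) := by
    have h1 : Real.exp 9 ≤ 3 ^ 9 := by
      have : Real.exp 9 = Real.exp 1 ^ 9 := by rw [← Real.exp_nat_mul]; norm_num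
      rw [this]
      gcongr
      linarith [Real.exp_one_lt_d9]
    have h2 : κ * Real.exp 9 = 1 := by rw [hκ, ← Real.exp_add]; norm_num
    have h3 : (3 : ℝ) ^ 9 ≤ M ^ 2 / 100 := by
      have : (80000 : ℝ) ^ 2 ≤ M ^ 2 := by gcongr; linarith
      linarith
    calc (1 : ℝ) = κ * Real.exp 9 := h2.symm
      _ ≤ κ * (M ^ 2 / 100) := by gcongr; linarith
  have t1 : κ / 4 * W ≤ c * (κ / L * q) := by
    calc κ / 4 * W = N ^ 2 / (4 * M ^ 2) * (κ / M * q) := by rw [hW]; field_simp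
      _ ≤ c * (κ / L * q) := by
          have : 0 ≤ c := le_trans (by positivity) hc
          gcongr
  have hexp6 : Real.exp (-(6 * y)) = (M ^ 6)⁻¹ := by
    rw [Real.exp_neg, hM, ← Real.exp_nat_mul]; norm_num
  have t2 : 2 * r * (N ^ 2 * b) ≤ κ / 8 * W := by
    calc 2 * r * (N ^ 2 * b) ≤ 2 * (2 * M) * (N ^ 2 * (q * (M ^ 6)⁻¹)) := by
          rw [hexp6] at hb
          gcongr
      _ = 4 / M ^ 2 * W := by rw [hW]; field_simp; norm_num
      _ ≤ κ / 8 * W := by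
          refine mul_le_mul_of_nonneg_right ?_ hW0.le
          rw [div_le_iff₀ (by positivity)]
          linarith
  have t3 : N + 2 * N * r ≤ κ / 8 * W := by
    -- Nq = exp(0.9 L) and 6y ≤ 0.9 L, so the linear terms N + 2Nr are negligible against N²q / M³.
    have h1 : M ^ 6 ≤ N * q := by
      rw [hM, ← Real.exp_nat_mul, hN, hq, ← Real.exp_add]
      refine Real.exp_le_exp.2 ?_
      push_cast
      linarith
    have hM1 : 1 ≤ M := by linarith
    calc N + 2 * N * r ≤ N + 2 * N * (2 * M) := by gcongr
      _ ≤ 5 * N * M := by nlinarith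
      _ = 5 * N * M * 1 := by ring
      _ ≤ 5 * N * M * (κ * (M ^ 2 / 100)) := by gcongr
      _ = κ / 20 * (N * M ^ 6 / M ^ 3) := by field_simp; ring
      _ ≤ κ / 20 * (N * (N * q) / M ^ 3) := by gcongr
      _ = κ / 20 * W := by rw [hW]; ring
      _ ≤ κ / 8 * W := by gcongr; norm_num
  linarith

/-- The parameters of an instance with `k ≥ n D log log n / log n`. -/
theorem Instance.Feasible.params {I : Instance n d} (hI : I.Feasible) (hn : 3 ≤ n)
    (hk : (n : ℝ) * (approxConst * Real.log (Real.log n) / Real.log n) ≤ I.k) :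
    0 < I.k ∧ 1 ≤ I.t ∧ 80000 ≤ Real.log n ∧
      Real.log (Real.log n) ≤ Real.log n / (approxConst * I.t) ∧ I.t ≤ Real.log n := by
  have hn' : (3 : ℝ) ≤ n := by exact_mod_cast hn
  have hn0 : (0 : ℝ) < n := by linarith
  have hll := log_log_ge hn'
  have hL0 : 0 < Real.log n := Real.log_pos (by linarith)
  set L := Real.log n with hL
  have hD : approxConst = 1000000 := rfl
  have hk0 : 0 < I.k := by
    refine lt_of_lt_of_le ?_ hk
    have : 0 < Real.log L := by linarith
    have : 0 < approxConst := by rw [hD]; norm_num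
    positivity
  have hkn := hI.k_le
  have ht1 : 1 ≤ I.t := by rw [Instance.t, one_le_div hk0]; exact hkn
  have htk : I.t * I.k = n := by rw [Instance.t]; field_simp
  have hmain : I.t * (approxConst * Real.log L) ≤ L := by
    have h1 : (n : ℝ) * (approxConst * Real.log L) ≤ I.k * L := by
      have := mul_le_mul_of_nonneg_right hk hL0.le
      have e : (n : ℝ) * (approxConst * Real.log L / L) * L = n * (approxConst * Real.log L) := by
        field_simp
      linarith
    rw [← htk] at h1
    refine le_of_mul_le_mul_left ?_ hk0
    linarith
  -- 10⁶ · 2/25 = 80000; with t ≥ 1, `hmain` then bounds both log n from below and t from above.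
  have h2 : 80000 ≤ approxConst * Real.log L := by rw [hD]; linarith
  refine ⟨hk0, ht1, ?_, ?_, ?_⟩
  · nlinarith
  · rw [le_div_iff₀ (by rw [hD]; positivity)]
    linarith
  · nlinarith

theorem Instance.Feasible.one_div_le_denseSamples {I : Instance n d} (hI : I.Feasible) (hn : 3 ≤ n)
    (hk : (n : ℝ) * (approxConst * Real.log (Real.log n) / Real.log n) ≤ I.k) :
    1 / (n : ℝ) ≤ (stdGaussian (EuclideanSpace ℝ (Fin d))).real
      (I.denseSamples ⌈(n : ℝ) ^ (1 / (approxConst * I.t))⌉₊) := by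
  obtain ⟨hk0, ht1, hL, hy, htL⟩ := hI.params hn hk
  have hn0 : (0 : ℝ) < n := by
    have : (3 : ℝ) ≤ n := by exact_mod_cast hn
    linarith
  have ht0 : 0 < I.t := by linarith
  set L := Real.log n with hLdef
  set y := L / (approxConst * I.t) with hydef
  have hD : approxConst = 1000000 := rfl
  have hM : (n : ℝ) ^ (1 / (approxConst * I.t)) = Real.exp y := by
    rw [Real.rpow_def_of_pos hn0, hydef]
    congr 1
    ring
  rw [hM]
  set r := ⌈Real.exp y⌉₊ with hr
  have hlogL : 0 ≤ Real.log L := Real.log_nonneg (by linarith)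
  have hr2 : (r : ℝ) ≤ 2 * Real.exp y := by
    have h1 := (Nat.ceil_lt_add_one (Real.exp_pos y).le).le
    have h2 : 1 ≤ Real.exp y := Real.one_le_exp (by linarith)
    linarith
  have hyt : approxConst * y * I.t = L := by
    have : approxConst ≠ 0 := by rw [hD]; norm_num
    rw [hydef]; field_simp
  have hy0 : 0 ≤ y := by linarith
  have hyL : 1000000 * y ≤ L := by
    rw [hD] at hyt
    nlinarith
  have hlM : L ≤ Real.exp y := by
    rw [← Real.exp_log (show 0 < L by linarith)]
    exact Real.exp_le_exp.2 hy
  -- k²/4 = n²/(4t²), and t ≤ L ≤ e^y.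
  have hc : (n : ℝ) ^ 2 / (4 * Real.exp y ^ 2) ≤ I.goodPairs.card := by
    refine le_trans ?_ (hI.card_goodPairs (by omega) hk0)
    have e : I.k = n / I.t := by rw [Instance.t]; field_simp
    rw [e, div_pow, div_div, mul_comm (I.t ^ 2)]
    gcongr
    linarith
  have hb : Real.exp (-(1 / 10 * L * (1 + 1 / (16 * I.t)))) ≤
      Real.exp (-(1 / 10 * L)) * Real.exp (-(6 * y)) := by
    rw [← Real.exp_add]
    refine Real.exp_le_exp.2 ?_
    -- Since L = 10⁶ y t, the extra exponent L/(160t) is 6250 y, of which 6y is needed.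
    have e : 1 / 10 * L * (1 + 1 / (16 * I.t)) = 1 / 10 * L + 6250 * y := by
      rw [← hyt, hD]; field_simp; ring
    rw [e]
    linarith
  have h1 := first_moment_ge (Real.exp_log hn0).symm hL hy hyL hc hr2 (Real.exp_pos _).le hb
  have h2 := h1.trans (hI.denseSamples_ge (Real.exp_pos _).le
    (fun p hp => hI.le_survivePair ht0 (by linarith) hp)
    (fun p hp => hI.survivePair_le ht0 hp) r)
  rw [div_le_iff₀ hn0]
  refine le_of_mul_le_mul_left ?_ hn0
  linarith

/-- The probability that no round has a dense surviving graph. -/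
theorem Instance.Feasible.gaussianSamples_forall_not_dense_le {I : Instance n d} (hI : I.Feasible)
    (hn : 3 ≤ n)
    (hk : (n : ℝ) * (approxConst * Real.log (Real.log n) / Real.log n) ≤ I.k) :
    gaussianSamples {ω | ∀ l < n ^ 3, block d ω l ∈
        (I.denseSamples ⌈(n : ℝ) ^ (1 / (approxConst * I.t))⌉₊)ᶜ} ≤
      ENNReal.ofReal (Real.exp (-(n : ℝ))) := by
  have hn' : (3 : ℝ) ≤ n := by exact_mod_cast hn
  have hm := I.measurableSet_denseSamples ⌈(n : ℝ) ^ (1 / (approxConst * I.t))⌉₊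
  have hp := hI.one_div_le_denseSamples hn hk
  rw [gaussianSamples_forall_block d _ hm.compl, ← ofReal_measureReal, probReal_compl_eq_one_sub hm,
    ← ENNReal.ofReal_pow (sub_nonneg.2 measureReal_le_one)]
  refine ENNReal.ofReal_le_ofReal ?_
  -- (1 - 1/n)^(n³) ≤ exp(-n²) ≤ exp(-n).
  calc (1 - (stdGaussian (EuclideanSpace ℝ (Fin d))).real
        (I.denseSamples ⌈(n : ℝ) ^ (1 / (approxConst * I.t))⌉₊)) ^ n ^ 3
      ≤ Real.exp (-(1 / (n : ℝ))) ^ n ^ 3 := by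
        refine pow_le_pow_left₀ (sub_nonneg.2 measureReal_le_one) ?_ _
        have := Real.add_one_le_exp (-(1 / (n : ℝ)))
        linarith
    _ = Real.exp (-(n : ℝ) ^ 2) := by
        rw [← Real.exp_nat_mul]
        congr 1
        push_cast
        field_simp
    _ ≤ Real.exp (-(n : ℝ)) := Real.exp_le_exp.2 (by nlinarith)

end BicliqueSDP

end

theorem theorem3 :
    ∃ (D : ℝ) (P : BicliqueSDP.Prog), 1 < D ∧ P.PolyTime ∧
      ∀ (n d : ℕ) (I : BicliqueSDP.Instance n d), 3 ≤ n → I.Feasible →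
        (n : ℝ) * (D * Real.log (Real.log n) / Real.log n) ≤ I.k →
        (∀ ω : ℕ → ℝ, I.RoundingOutput ω (P.outU I ω) (P.outV I ω)) ∧
        BicliqueSDP.gaussianSamples
            {ω | ¬ (BicliqueSDP.IsBalancedBiclique I.adj (P.outU I ω) (P.outV I ω) ∧
              (n : ℝ) ^ (1 / (D * I.t)) ≤ ((P.outU I ω).card : ℝ))} ≤
          ENNReal.ofReal (Real.exp (-(n : ℝ))) := by
  refine ⟨BicliqueSDP.approxConst, BicliqueSDP.roundingProg, by norm_num [BicliqueSDP.approxConst],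
    BicliqueSDP.roundingProg_tame.polyTime, fun n d I hn hI hk => ?_⟩
  have hcorrect := fun ω => BicliqueSDP.roundingProg_correct I (by omega) ω
  refine ⟨fun ω => (hcorrect ω).1,
    (measure_mono ?_).trans (hI.gaussianSamples_forall_not_dense_le hn hk)⟩
  -- A single dense round already forces a large output, so failure lies in the event that no round
  -- is dense. Monotonicity of the measure needs no measurability of the failure set.
  intro ω hω l hl hdense
  refine hω ⟨?_, ?_⟩
  · obtain ⟨m, _, hm⟩ := (hcorrect ω).1.1
    exact hm.card_eq.2
  · refine (Nat.le_ceil _).trans (Nat.cast_le.2 ?_)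
    exact (I.le_extractionParam (by omega) hdense).trans ((hcorrect ω).2 l hl)
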